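/- Let $g\ge 0$ and $n\ge 0$ be integers and let $\mathbb K$ be an algebraically closed field with $\operatorname{char}\mathbb K\neq 2$. Let $\varphi\in\mathbb K$ be a primitive $m$-th root of unity ($m\ge1$) and let $m_1,\dots,m_n$ be natural numbers such that $\prod_{j\in J}\varphi^{m_j}\neq\prod_{l\in L}\varphi^{m_l}$ for all disjoint $J,L\subseteq\{1,\dots,n\}$ that are not both empty, and $\varphi^{2m_i}\neq 1$ for every $i$. Put $\xi=\operatorname{diag}(\varphi^{m_1},\dots,\varphi^{m_n},\varphi^{-m_1},\dots,\varphi^{-m_n})$, let $\mathrm{Sp}(2n,\mathbb K)$ be the group of $2n\times 2n$ matrices $A$ with $A^tJA=J$, $J=\begin{pmatrix}0&I_n\\-I_n&0\end{pmatrix}$, and let $$\mu:\mathrm{Sp}(2n,\mathbb K)^{2g}\to\mathrm{Sp}(2n,\mathbb K),\qquad \mu(A_1,B_1,\dots,A_g,B_g)=\prod_{i=1}^g[A_i,B_i],\qquad [A,B]=ABA^{-1}B^{-1}.$$ Then the affine variety $\mathcal U_n^\xi=\mu^{-1}(\xi)=\{(A_i,B_i)\in\mathrm{Sp}(2n,\mathbb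 K)^{2g}:\prod_{i=1}^g[A_i,B_i]=\xi\}$ is nonsingular, and each of its irreducible components and each of its connected components has dimension $(2g-1)n(2n+1)$; if $g\ge 1$, then $\dim\mathcal U_n^\xi=(2g-1)n(2n+1)$ (in particular $\mathcal U_n^\xi\neq\emptyset$). Moreover, at every $s\in\mathcal U_n^\xi$ the differential $d\mu_s:T_s\,\mathrm{Sp}(2n,\mathbb K)^{2g}\to T_\xi\,\mathrm{Sp}(2n,\mathbb K)$ is surjective. -/

import Mathlib

open Matrix

namespace SpCharVar

noncomputable section

/-- The map `Sp(2n, R) → Sp(2n, S)` induced by a ring homomorphism `R → S`. -/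
def spMap (n : ℕ) {R S : Type*} [CommRing R] [CommRing S] (f : R →+* S)
    (A : symplecticGroup (Fin n) R) : symplecticGroup (Fin n) S :=
  ⟨(A : Matrix (Fin n ⊕ Fin n) (Fin n ⊕ Fin n) R).map f, SymplecticGroup.map_mem A.2 f⟩

theorem spMap_mul (n : ℕ) {R S : Type*} [CommRing R] [CommRing S] (f : R →+* S)
    (A B : symplecticGroup (Fin n) R) : spMap n f (A * B) = spMap n f A * spMap n f B :=
  Subtype.ext (by simp [spMap, Matrix.map_mul])

/-- `spMap` as a group homomorphism. -/
def spHom (n : ℕ) {R S : Type*} [CommRing R] [CommRing S] (f : R →+* S) :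
    symplecticGroup (Fin n) R →* symplecticGroup (Fin n) S :=
  MonoidHom.mk' (spMap n f) (spMap_mul n f)

/-- The map `μ (A₁, B₁, …, A_g, B_g) = [A₁, B₁] ⋯ [A_g, B_g]` on the `2g`-tuples of elements of a
group, where `[a, b] = a b a⁻¹ b⁻¹` and the product is taken in this order. -/
def mu {G : Type*} [Group G] {g : ℕ} (A B : Fin g → G) : G :=
  (List.ofFn fun i => A i * B i * (A i)⁻¹ * (B i)⁻¹).prod

theorem map_mu {G H : Type*} [Group G] [Group H] (f : G →* H) {g : ℕ} (A B : Fin g → G) :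
    f (mu A B) = mu (fun i => f (A i)) (fun i => f (B i)) := by
  simp [mu, map_list_prod, List.map_ofFn, Function.comp_def]

/-- The genericity condition on the exponents `k₁, …, kₙ`: the products of the `φ ^ kⱼ` over two
disjoint sets of indices, not both empty, are different, and no `φ ^ kᵢ` has square `1`. -/
def Generic {K : Type*} [Field K] {n : ℕ} (φ : K) (k : Fin n → ℕ) : Prop :=
  (∀ J L : Finset (Fin n), Disjoint J L → (J.Nonempty ∨ L.Nonempty) →
    ∏ j ∈ J, φ ^ k j ≠ ∏ l ∈ L, φ ^ k l) ∧
  ∀ i, φ ^ (2 * k i) ≠ 1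

/-- `ξ = diag (φ ^ k₁, …, φ ^ kₙ, φ ^ (-k₁), …, φ ^ (-kₙ))`. -/
def xi {K : Type*} [Field K] {n : ℕ} (φ : K) (k : Fin n → ℕ) :
    Matrix (Fin n ⊕ Fin n) (Fin n ⊕ Fin n) K :=
  Matrix.diagonal (Sum.elim (fun i => φ ^ k i) (fun i => (φ ^ k i)⁻¹))

/-- Indices for the matrix entries of a tuple `(A₁, …, A_g, B₁, …, B_g)` of `2n × 2n` matrices. -/
abbrev Entry (g n : ℕ) : Type :=
  (Fin g ⊕ Fin g) × (Fin n ⊕ Fin n) × (Fin n ⊕ Fin n)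

/-- The point of the affine space of `2g`-tuples of `2n × 2n` matrices that is given by a tuple
of symplectic matrices. -/
def point {K : Type*} [Field K] {g n : ℕ} (A B : Fin g → symplecticGroup (Fin n) K) :
    Entry g n → K :=
  fun e => Sum.elim (fun i => (A i : Matrix (Fin n ⊕ Fin n) (Fin n ⊕ Fin n) K))
    (fun i => (B i : Matrix (Fin n ⊕ Fin n) (Fin n ⊕ Fin n) K)) e.1 e.2.1 e.2.2

/-- The set `{(A, B) ∈ Sp(2n, K) ^ (2g) : [A₁, B₁] ⋯ [A_g, B_g] = ξ}`, inside the affine space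
of `2g`-tuples of `2n × 2n` matrices. -/
def U {K : Type*} [Field K] (g : ℕ) {n : ℕ} (ξ : Matrix (Fin n ⊕ Fin n) (Fin n ⊕ Fin n) K) :
    Set (Entry g n → K) :=
  {x | ∃ A B : Fin g → symplecticGroup (Fin n) K,
    (mu A B).1 = ξ ∧ x = point A B}

/-- The coordinate ring of the affine variety `U`: polynomials in the matrix entries modulo
those that vanish on `U`. -/
abbrev CoordRing {K : Type*} [Field K] (g : ℕ) {n : ℕ}
    (ξ : Matrix (Fin n ⊕ Fin n) (Fin n ⊕ Fin n) K) : Type _ :=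
  MvPolynomial (Entry g n) K ⧸ MvPolynomial.vanishingIdeal K (U g ξ)

/-- The tangent space `T_A Sp(2n, K)`: the points `A + ε X` of `Sp(2n)` over the dual numbers
`K[ε]` that reduce to `A` at `ε = 0`. -/
def Tangent {K : Type*} [Field K] {n : ℕ} (A : symplecticGroup (Fin n) K) : Type _ :=
  {X : symplecticGroup (Fin n) (DualNumber K) //
    spHom n (TrivSqZeroExt.fstHom K K K).toRingHom X = A}

/-- The differential of `μ : Sp(2n, K) ^ (2g) → Sp(2n, K)` at `(A, B)`: the map on points over the
dual numbers, `μ (A + ε X, B + ε Y) = μ (A, B) + ε dμ (X, Y)`. -/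
def dmu {K : Type*} [Field K] {g n : ℕ} (A B : Fin g → symplecticGroup (Fin n) K)
    (v : (∀ i, Tangent (A i)) × (∀ i, Tangent (B i))) : Tangent (mu A B) :=
  ⟨mu (fun i => (v.1 i).1) (fun i => (v.2 i).1), by
    rw [map_mu]
    congr 1
    · funext i
      exact (v.1 i).2
    · funext i
      exact (v.2 i).2⟩

end

end SpCharVar

namespace SpCharVar

section RegularLocal

open IsLocalRing

/-- A regular local ring modulo elements of the maximal ideal that are linearly independent in the
cotangent space is regular, and its dimension drops by the number of these elements. -/
theorem isRegularLocalRing_quotient_span {R : Type*} [CommRing R] [IsRegularLocalRing R]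
    {ι : Type*} [Fintype ι] (f : ι → maximalIdeal R)
    (hf : LinearIndependent (ResidueField R) fun i => (maximalIdeal R).toCotangent (f i)) :
    IsRegularLocalRing (R ⧸ Ideal.span (Set.range fun i => (f i : R))) ∧
      ringKrullDim (R ⧸ Ideal.span (Set.range fun i => (f i : R))) + Fintype.card ι =
        ringKrullDim R := by
  classical
  set I := Ideal.span (Set.range fun i => (f i : R)) with hI
  have hIm : I ≤ maximalIdeal R := by
    rw [hI, Ideal.span_le]
    rintro _ ⟨i, rfl⟩
    exact (f i).2
  have : Nontrivial (R ⧸ I) :=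
    Ideal.Quotient.nontrivial_iff.2 (ne_top_of_le_ne_top (maximalIdeal.isMaximal R).ne_top hIm)
  have : IsLocalRing (R ⧸ I) := .of_surjective' _ Ideal.Quotient.mk_surjective
  let W := Submodule.span (ResidueField R)
    (Set.range fun i => (maximalIdeal R).toCotangent (f i))
  obtain ⟨W', hW'⟩ := Submodule.exists_isCompl W
  have hW : Module.finrank (ResidueField R) W = Fintype.card ι := finrank_span_eq_card hf
  have hadd : Fintype.card ι + Module.finrank (ResidueField R) W' =
      Module.finrank (ResidueField R) (CotangentSpace R) := by
    rw [← hW]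
    exact Submodule.finrank_add_eq_of_isCompl hW'
  let b := Module.finBasis (ResidueField R) W'
  choose y hy using fun j => (maximalIdeal R).toCotangent_surjective (b j : CotangentSpace R)
  have hspan : Submodule.span R (Set.range f ∪ Set.range y) = ⊤ := by
    rw [← CotangentSpace.span_image_eq_top_iff, Set.image_union, Submodule.span_union,
      ← Set.range_comp, ← Set.range_comp, ← hW'.sup_eq_top]
    congr 1
    have : (⇑(maximalIdeal R).toCotangent ∘ y) = W'.subtype ∘ b := funext hy
    rw [this, Set.range_comp, Submodule.span_image, b.span_eq, Submodule.map_subtype_top]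
  have hmax : maximalIdeal (R ⧸ I) =
      Ideal.span (Set.range fun j => Ideal.Quotient.mk I (y j : R)) := by
    rw [← map_maximalIdeal_of_surjective (Ideal.Quotient.mk I) Ideal.Quotient.mk_surjective]
    apply le_antisymm
    · rw [Ideal.map_le_iff_le_comap]
      intro x hx
      have hx' : (⟨x, hx⟩ : maximalIdeal R) ∈ Submodule.span R (Set.range f ∪ Set.range y) :=
        hspan ▸ Submodule.mem_top
      have key : Submodule.span R (Set.range f ∪ Set.range y) ≤
          Submodule.comap (maximalIdeal R).subtype
            (Ideal.comap (Ideal.Quotient.mk I)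
              (Ideal.span (Set.range fun j => Ideal.Quotient.mk I (y j : R)))) := by
        rw [Submodule.span_le]
        rintro _ (⟨i, rfl⟩ | ⟨j, rfl⟩)
        · have : Ideal.Quotient.mk I (f i : R) = 0 :=
            Ideal.Quotient.eq_zero_iff_mem.2 (Ideal.subset_span ⟨i, rfl⟩)
          simp [this]
        · exact Ideal.subset_span ⟨j, rfl⟩
      exact key hx'
    · rw [Ideal.span_le]
      rintro _ ⟨j, rfl⟩
      exact Ideal.mem_map_of_mem _ (y j).2
  have hle : (maximalIdeal (R ⧸ I)).spanFinrank ≤ Module.finrank (ResidueField R) W' := by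
    rw [hmax]
    refine (Submodule.spanFinrank_span_le_ncard_of_finite (Set.finite_range _)).trans ?_
    rw [← Set.image_univ]
    refine (Set.ncard_image_le Set.finite_univ).trans ?_
    simp
  have hdim : ringKrullDim R ≤ ringKrullDim (R ⧸ I) + Fintype.card ι := by
    refine (ringKrullDim_le_ringKrullDim_quotient_add_encard
      (Set.range fun i => (f i : R)) ?_).trans ?_
    · rintro _ ⟨i, rfl⟩
      rw [IsLocalRing.ringJacobson_eq_maximalIdeal]
      exact (f i).2
    · gcongr
      have h1 : (Set.range fun i => (f i : R)).encard ≤ Fintype.card ι := by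
        rw [← Set.image_univ]
        refine (Set.encard_image_le _ _).trans ?_
        simp
      exact_mod_cast h1
  have hreg := (IsRegularLocalRing.iff_finrank_cotangentSpace R).1 inferInstance
  have hle2 := ringKrullDim_le_spanFinrank_maximalIdeal (R ⧸ I)
  rw [← hreg, ← hadd] at hdim
  have hnn : (0 : WithBot ℕ∞) ≤ ringKrullDim (R ⧸ I) := ringKrullDim_nonneg_of_nontrivial
  obtain ⟨e, he⟩ : ∃ e : ℕ, ringKrullDim (R ⧸ I) = e := by
    have h2 : ringKrullDim (R ⧸ I) ≠ ⊤ := ringKrullDim_ne_top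
    have h3 : ringKrullDim (R ⧸ I) ≠ ⊥ := ringKrullDim_ne_bot
    lift ringKrullDim (R ⧸ I) to ℕ∞ using h3 with e he
    have h4 : e ≠ ⊤ := by rintro rfl; exact h2 rfl
    lift e to ℕ using h4
    exact ⟨e, rfl⟩
  rw [he] at hdim hle2
  have h5 : Fintype.card ι + Module.finrank (ResidueField R) W' ≤ e + Fintype.card ι := by
    exact_mod_cast hdim
  have h6 : e ≤ (maximalIdeal (R ⧸ I)).spanFinrank := by exact_mod_cast hle2
  refine ⟨.of_spanFinrank_maximalIdeal_le _ ?_, ?_⟩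
  · rw [he]
    exact_mod_cast (by omega : (maximalIdeal (R ⧸ I)).spanFinrank ≤ e)
  · rw [he, ← hreg, ← hadd]
    exact_mod_cast (by omega : e + Fintype.card ι =
      Fintype.card ι + Module.finrank (ResidueField R) W')

/-- A regular local ring is a domain. -/
theorem isDomain_of_isRegularLocalRing (R : Type*) [CommRing R] [IsRegularLocalRing R] :
    IsDomain R := by
  obtain ⟨d, hd⟩ : ∃ d, (maximalIdeal R).spanFinrank = d := ⟨_, rfl⟩
  induction d generalizing R with
  | zero =>
    have h0 : maximalIdeal R = ⊥ :=
      (Submodule.spanFinrank_eq_zero_iff_eq_bot (maximalIdeal R).fg_of_isNoetherianRing).1 hd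
    exact ((isField_iff_maximalIdeal_eq (R := R)).2 h0).isDomain
  | succ d ih =>
    have hfg := (maximalIdeal R).fg_of_isNoetherianRing
    have hdim : ((d + 1 : ℕ) : WithBot ℕ∞) = ringKrullDim R := by
      rw [← hd]
      exact IsRegularLocalRing.spanFinrank_maximalIdeal
    have hmin := Ideal.finite_minimalPrimes_of_isNoetherianRing R ⊥
    obtain ⟨x, hxm, hx⟩ : ∃ x ∈ maximalIdeal R, x ∉ maximalIdeal R ^ 2 ∧
        ∀ p ∈ (⊥ : Ideal R).minimalPrimes, x ∉ p := by
      by_contra! hcon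
      have hcov : ((maximalIdeal R : Ideal R) : Set R) ⊆
          ⋃ p ∈ ((insert (maximalIdeal R ^ 2) hmin.toFinset : Finset (Ideal R)) :
            Set (Ideal R)), (p : Set R) := by
        intro x hx
        by_cases h2 : x ∈ maximalIdeal R ^ 2
        · exact Set.mem_biUnion (x := maximalIdeal R ^ 2) (by simp) h2
        · obtain ⟨p, hp, hxp⟩ := hcon x hx h2
          exact Set.mem_biUnion (x := p) (by simp [hp]) hxp
      rw [Ideal.subset_union_prime (f := fun p => p) (maximalIdeal R ^ 2) (maximalIdeal R ^ 2)
        (fun p hp hp' _ => by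
          have hp2 : p ∈ (⊥ : Ideal R).minimalPrimes := by simpa [hp'] using hp
          exact hp2.1.1)] at hcov
      obtain ⟨p, hp, hle⟩ := hcov
      rcases Finset.mem_insert.1 hp with rfl | hp
      · have hbot : maximalIdeal R = ⊥ := by
          refine Submodule.eq_bot_of_le_smul_of_le_jacobson_bot (maximalIdeal R) _ hfg ?_ ?_
          · simpa [pow_two] using hle
          · rw [jacobson_eq_maximalIdeal _ bot_ne_top]
        rw [hbot] at hd
        simp at hd
      · have hp2 : p ∈ (⊥ : Ideal R).minimalPrimes := by simpa using hp
        have := hp2.1.1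
        have hpm : p = maximalIdeal R :=
          ((maximalIdeal.isMaximal R).eq_of_le this.ne_top hle).symm
        have hz : p.height = 0 := Ideal.height_eq_zero_iff.2 hp2
        rw [← maximalIdeal_height_eq_ringKrullDim, ← hpm, hz] at hdim
        have : d + 1 = 0 := by exact_mod_cast hdim
        omega
    have hli : LinearIndependent (ResidueField R)
        fun _ : Unit => (maximalIdeal R).toCotangent ⟨x, hxm⟩ := by
      refine Fintype.linearIndependent_iff.2 fun c hc i => ?_
      by_contra hci
      refine hx.1 ((Ideal.toCotangent_eq_zero _ ⟨x, hxm⟩).1 ?_)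
      rw [Fintype.sum_unique] at hc
      rw [← inv_smul_smul₀ hci ((maximalIdeal R).toCotangent ⟨x, hxm⟩)]
      exact (congrArg _ hc).trans (smul_zero _)
    obtain ⟨J, rfl, hreg, hd'⟩ : ∃ J : Ideal R, J = Ideal.span {x} ∧
        IsRegularLocalRing (R ⧸ J) ∧ ringKrullDim (R ⧸ J) + 1 = ((d + 1 : ℕ) : WithBot ℕ∞) := by
      refine ⟨_, ?_, (isRegularLocalRing_quotient_span (fun _ : Unit => ⟨x, hxm⟩) hli).1, ?_⟩
      · rw [Set.range_const]
      · rw [hdim, ← (isRegularLocalRing_quotient_span (fun _ : Unit => ⟨x, hxm⟩) hli).2]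
        simp
    have hdom : IsDomain (R ⧸ Ideal.span {x}) := by
      refine ih _ ?_
      have h1 := IsRegularLocalRing.spanFinrank_maximalIdeal (R := R ⧸ Ideal.span {x})
      rw [← h1] at hd'
      have : (maximalIdeal (R ⧸ Ideal.span {x})).spanFinrank + 1 = d + 1 := by
        exact_mod_cast hd'
      omega
    have hprime : (Ideal.span {x}).IsPrime := (Ideal.Quotient.isDomain_iff_prime _).1 hdom
    obtain ⟨p, hp, hpx⟩ := Ideal.exists_minimalPrimes_le (bot_le : ⊥ ≤ Ideal.span {x})
    have hpp : p.IsPrime := hp.1.1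
    have hp0 : p = ⊥ := by
      refine Submodule.eq_bot_of_le_smul_of_le_jacobson_bot (maximalIdeal R) _
        p.fg_of_isNoetherianRing ?_ ?_
      · intro y hy
        obtain ⟨a, rfl⟩ := Ideal.mem_span_singleton'.1 (hpx hy)
        have ha : a ∈ p := (hpp.mem_or_mem hy).resolve_right (hx.2 p hp)
        rw [mul_comm, ← smul_eq_mul]
        exact Submodule.smul_mem_smul hxm ha
      · rw [jacobson_eq_maximalIdeal _ bot_ne_top]
    rw [hp0] at hpp
    exact IsDomain.of_bot_isPrime R

end RegularLocal

section Jacobian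

open IsLocalRing

/-- A derivation maps the square of an ideal into the ideal. -/
theorem derivation_mem_of_mem_sq {k R : Type*} [CommRing k] [CommRing R] [Algebra k R]
    (D : Derivation k R R) (p : Ideal R) {a : R} (ha : a ∈ p ^ 2) : D a ∈ p := by
  rw [pow_two] at ha
  induction ha using Submodule.mul_induction_on' with
  | mem_mul_mem a ha b hb =>
    rw [D.leibniz, smul_eq_mul, smul_eq_mul]
    exact p.add_mem (p.mul_mem_right _ ha) (p.mul_mem_right _ hb)
  | add a _ b _ ha hb =>
    rw [map_add]
    exact p.add_mem ha hb

/-- The Jacobian criterion for linear independence in the cotangent space of a prime ideal. -/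
theorem linearIndependent_toCotangent_of_det_notMem {k R : Type*} [CommRing k] [CommRing R]
    [Algebra k R] (p : Ideal R) [p.IsPrime] {ι : Type*} [Fintype ι] [DecidableEq ι] (f : ι → R)
    (D : ι → Derivation k R R) (hdet : (Matrix.of fun i j => D i (f j)).det ∉ p)
    (f' : ι → maximalIdeal (Localization.AtPrime p))
    (hf' : ∀ i, (f' i : Localization.AtPrime p) = algebraMap R _ (f i)) :
    LinearIndependent (ResidueField (Localization.AtPrime p))
      fun i => (maximalIdeal (Localization.AtPrime p)).toCotangent (f' i) := by
  have hf : ∀ i, f i ∈ p := fun i =>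
    (IsLocalization.AtPrime.to_map_mem_maximal_iff (Localization.AtPrime p) p (f i)).1
      (hf' i ▸ (f' i).2)
  refine Fintype.linearIndependent_iff.2 fun c hc => ?_
  choose a ha using fun i => residue_surjective (c i)
  obtain ⟨s, hs⟩ := IsLocalization.exist_integer_multiples_of_finite p.primeCompl a
  choose r hr using hs
  have h1 : ∑ i, a i * algebraMap R (Localization.AtPrime p) (f i) ∈
      maximalIdeal (Localization.AtPrime p) ^ 2 := by
    have h0 : (maximalIdeal (Localization.AtPrime p)).toCotangent (∑ i, a i • f' i) = 0 := by
      rw [map_sum, ← hc]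
      refine Finset.sum_congr rfl fun i _ => ?_
      rw [map_smul, ← ha]
      rfl
    have := (Ideal.toCotangent_eq_zero _ _).1 h0
    simpa [hf'] using this
  have h2 : algebraMap R (Localization.AtPrime p) (∑ i, r i * f i) ∈
      Ideal.map (algebraMap R (Localization.AtPrime p)) (p ^ 2) := by
    rw [Ideal.map_pow, Localization.AtPrime.map_eq_maximalIdeal, map_sum]
    have h3 := Ideal.mul_mem_left _ (algebraMap R (Localization.AtPrime p) s) h1
    rw [Finset.mul_sum] at h3
    convert h3 using 2 with i
    rw [map_mul, hr, Algebra.smul_def, mul_assoc]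
  rw [IsLocalization.algebraMap_mem_map_algebraMap_iff p.primeCompl] at h2
  obtain ⟨t, ht, htm⟩ := h2
  have h4 : (Ideal.Quotient.mk p).mapMatrix (Matrix.of fun i j => D i (f j)) *ᵥ
      (fun j => Ideal.Quotient.mk p (t * r j)) = 0 := by
    funext i
    have h5 := derivation_mem_of_mem_sq (D i) p htm
    have h6 : D i (t * ∑ j, r j * f j) =
        ∑ j, D i (f j) * (t * r j) + ∑ j, f j * D i (t * r j) := by
      rw [Finset.mul_sum, map_sum, ← Finset.sum_add_distrib]
      refine Finset.sum_congr rfl fun j _ => ?_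
      rw [← mul_assoc, (D i).leibniz, smul_eq_mul, smul_eq_mul]
      ring
    rw [h6] at h5
    have h7 : ∑ j, f j * D i (t * r j) ∈ p :=
      Ideal.sum_mem _ fun j _ => p.mul_mem_right _ (hf j)
    have h8 := Ideal.Quotient.eq_zero_iff_mem.2 ((p.add_mem_iff_left h7).1 h5)
    simpa [Matrix.mulVec, dotProduct] using h8
  have h9 := Matrix.eq_zero_of_mulVec_eq_zero (by
    rw [← RingHom.map_det]
    exact fun h => hdet (Ideal.Quotient.eq_zero_iff_mem.1 h)) h4
  intro i
  have h10 : t * r i ∈ p := Ideal.Quotient.eq_zero_iff_mem.1 (congrFun h9 i)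
  have h11 : r i ∈ p := (Ideal.IsPrime.mem_or_mem ‹_› h10).resolve_left ht
  have h12 := (IsLocalization.AtPrime.to_map_mem_maximal_iff (Localization.AtPrime p) p (r i)).2 h11
  rw [hr, Algebra.smul_def] at h12
  have h13 : a i ∈ maximalIdeal (Localization.AtPrime p) := by
    refine (Ideal.IsPrime.mem_or_mem inferInstance h12).resolve_left fun h => s.2 ?_
    exact (IsLocalization.AtPrime.to_map_mem_maximal_iff (Localization.AtPrime p) p s).1 h
  rw [← ha]
  exact (residue_eq_zero_iff _).2 h13

/-- The Jacobian criterion for regularity: if an ideal `I` of a regular ring agrees up to radicals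
with the ideal generated by `f₁, …, f_c` on a neighbourhood of a prime ideal `p`, and a Jacobian
determinant of `f₁, …, f_c` does not vanish at `p`, then `I` defines a regular local ring at `p`. -/
theorem isRegularLocalRing_quotient_of_det_notMem {k R : Type*} [CommRing k] [CommRing R]
    [Algebra k R] [IsRegularRing R] (I : Ideal R) (q : Ideal (R ⧸ I)) [q.IsPrime]
    {ι : Type*} [Fintype ι] [DecidableEq ι] (f : ι → R) (D : ι → Derivation k R R) (h : R)
    (hf : ∀ i, f i ∈ I) (hh : h ∉ q.comap (Ideal.Quotient.mk I))
    (hI : ∀ a ∈ I, h * a ∈ (Ideal.span (Set.range f)).radical)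
    (hdet : (Matrix.of fun i j => D i (f j)).det ∉ q.comap (Ideal.Quotient.mk I)) :
    IsRegularLocalRing (Localization.AtPrime q) ∧
      ringKrullDim (Localization.AtPrime q) + Fintype.card ι =
        ringKrullDim (Localization.AtPrime (q.comap (Ideal.Quotient.mk I))) := by
  set p := q.comap (Ideal.Quotient.mk I) with hp
  have hIp : I ≤ p := fun a ha => by
    rw [hp, Ideal.mem_comap, Ideal.Quotient.eq_zero_iff_mem.2 ha]
    exact q.zero_mem
  let f' : ι → maximalIdeal (Localization.AtPrime p) := fun i =>
    ⟨algebraMap R _ (f i),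
      (IsLocalization.AtPrime.to_map_mem_maximal_iff (Localization.AtPrime p) p (f i)).2
        (hIp (hf i))⟩
  obtain ⟨hreg, hdim⟩ := isRegularLocalRing_quotient_span f'
    (linearIndependent_toCotangent_of_det_notMem p f D hdet f' fun _ => rfl)
  have hspan : Ideal.span (Set.range fun i => (f' i : Localization.AtPrime p)) =
      (Ideal.span (Set.range f)).map (algebraMap R (Localization.AtPrime p)) := by
    rw [Ideal.map_span, ← Set.range_comp]
    rfl
  rw [hspan] at hreg hdim
  have hprime := (Ideal.Quotient.isDomain_iff_prime _).1
    (isDomain_of_isRegularLocalRing (Localization.AtPrime p ⧸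
      (Ideal.span (Set.range f)).map (algebraMap R (Localization.AtPrime p))))
  have hmap : (Ideal.span (Set.range f)).map (algebraMap R (Localization.AtPrime p)) =
      I.map (algebraMap R (Localization.AtPrime p)) := by
    apply le_antisymm
    · apply Ideal.map_mono
      rw [Ideal.span_le]
      rintro _ ⟨i, rfl⟩
      exact hf i
    · rw [Ideal.map_le_iff_le_comap]
      intro a ha
      obtain ⟨m, hm⟩ := hI a ha
      have h1 := Ideal.mem_map_of_mem (algebraMap R (Localization.AtPrime p)) hm
      rw [map_pow] at h1
      replace h1 := hprime.mem_of_pow_mem m h1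
      rw [map_mul] at h1
      exact (Ideal.unit_mul_mem_iff_mem _
        (IsLocalization.map_units (Localization.AtPrime p) (⟨h, hh⟩ : p.primeCompl))).1 h1
  rw [hmap] at hreg hdim
  have hM : Submonoid.map (Ideal.Quotient.mk I) p.primeCompl = q.primeCompl := by
    ext a
    constructor
    · rintro ⟨b, hb, rfl⟩
      exact hb
    · intro ha
      obtain ⟨b, rfl⟩ := Ideal.Quotient.mk_surjective a
      exact ⟨b, ha, rfl⟩
  have hker := IsLocalization.ker_map (S := Localization.AtPrime p) (Localization.AtPrime q)
    (Ideal.Quotient.mk I) hM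
  rw [Ideal.mk_ker] at hker
  have hsurj : Function.Surjective (IsLocalization.map (S := Localization.AtPrime p)
      (Localization.AtPrime q) (Ideal.Quotient.mk I)
      (hM ▸ p.primeCompl.le_comap_map : p.primeCompl ≤ q.primeCompl.comap _)) := by
    have : IsLocalization (Submonoid.map (Ideal.Quotient.mk I) p.primeCompl)
        (Localization.AtPrime q) := by
      rw [hM]
      infer_instance
    exact IsLocalization.map_surjective_of_surjective _ _ _ Ideal.Quotient.mk_surjective
  let e := (Ideal.quotEquivOfEq hker.symm).trans
    (RingHom.quotientKerEquivOfSurjective hsurj)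
  exact ⟨.of_ringEquiv e, by rw [← ringKrullDim_eq_of_ringEquiv e, hdim]⟩

/-- The local ring of affine space at a point has dimension the number of coordinates. -/
theorem ringKrullDim_localization_mvPolynomial {K σ : Type*} [Field K] [Fintype σ] (x : σ → K)
    (p : Ideal (MvPolynomial σ K)) [p.IsPrime] (hx : ∀ a ∈ p, MvPolynomial.eval x a = 0)
    (hx' : ∀ a, MvPolynomial.eval x a = 0 → a ∈ p) :
    ringKrullDim (Localization.AtPrime p) = Fintype.card σ := by
  classical
  apply le_antisymm
  · rw [IsLocalization.AtPrime.ringKrullDim_eq_height p]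
    refine (Ideal.height_le_ringKrullDim_of_ne_top Ideal.IsPrime.ne_top').trans ?_
    simp
  · let f : σ → MvPolynomial σ K := fun i => MvPolynomial.X i - MvPolynomial.C (x i)
    let f' : σ → maximalIdeal (Localization.AtPrime p) := fun i =>
      ⟨algebraMap _ _ (f i),
        (IsLocalization.AtPrime.to_map_mem_maximal_iff (Localization.AtPrime p) p (f i)).2
          (hx' _ (by simp [f]))⟩
    have hli := linearIndependent_toCotangent_of_det_notMem (k := K) p f MvPolynomial.pderiv
      (by
        have : (Matrix.of fun i j => MvPolynomial.pderiv i (f j)) =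
            (1 : Matrix σ σ (MvPolynomial σ K)) := by
          ext1 i j
          simp [f, Matrix.one_apply, Pi.single_apply, MvPolynomial.pderiv_X, eq_comm]
        rw [this, Matrix.det_one]
        exact fun h => by simpa using hx _ h) f' fun _ => rfl
    rw [← (IsRegularLocalRing.iff_finrank_cotangentSpace (Localization.AtPrime p)).1 inferInstance]
    exact_mod_cast hli.fintype_card_le_finrank

end Jacobian

section Dimension

/-- If all local rings of `A` at maximal ideals are domains of dimension `d`, then all irreducible
components of the spectrum have dimension `d`. -/
theorem topologicalKrullDim_eq_of_localization {A : Type*} [CommRing A] (d : ℕ)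
    (hdom : ∀ (m : Ideal A) [m.IsMaximal], IsDomain (Localization.AtPrime m))
    (hdim : ∀ (m : Ideal A) [m.IsMaximal], ringKrullDim (Localization.AtPrime m) = d) :
    (∀ Z ∈ irreducibleComponents (PrimeSpectrum A), topologicalKrullDim Z = d) ∧
      (∀ p : PrimeSpectrum A, topologicalKrullDim (connectedComponent p) = d) ∧
      (Nontrivial A → topologicalKrullDim (PrimeSpectrum A) = d) := by
  have hle : topologicalKrullDim (PrimeSpectrum A) ≤ d := by
    rw [PrimeSpectrum.topologicalKrullDim_eq_ringKrullDim, ringKrullDim_le_iff_isMaximal_height_le]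
    intro m hm
    rw [← IsLocalization.AtPrime.ringKrullDim_eq_height m (Localization.AtPrime m), hdim m]
  have hcomp : ∀ Z ∈ irreducibleComponents (PrimeSpectrum A),
      (d : WithBot ℕ∞) ≤ topologicalKrullDim Z := by
    intro Z hZ
    have hcl := isClosed_of_mem_irreducibleComponents Z hZ
    obtain ⟨q, hq⟩ := QuasiSober.sober hZ.1 hcl
    obtain ⟨m, hm, hqm⟩ := Ideal.exists_le_maximal q.asIdeal q.2.ne_top
    have := hdom m
    let φ := PrimeSpectrum.comap (algebraMap A (Localization.AtPrime m))
    have hrange : Set.range φ = {p | Disjoint (m.primeCompl : Set A) p.asIdeal} :=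
      PrimeSpectrum.localization_comap_range _ m.primeCompl
    have hirr : IsIrreducible (closure (Set.range φ)) := by
      rw [← Set.image_univ]
      exact ((irreducibleSpace_def _).1 inferInstance |>.image φ
        (PrimeSpectrum.continuous_comap _).continuousOn).closure
    have hqr : q ∈ Set.range φ := by
      rw [hrange]
      exact Set.disjoint_left.2 fun a ha hb => ha (hqm hb)
    have hZle : Z ≤ closure (Set.range φ) := by
      rw [← hq.def]
      exact closure_mono (Set.singleton_subset_iff.2 hqr)
    have hsub : ∀ y, φ y ∈ Z := fun y => hZ.2 hirr hZle (subset_closure ⟨y, rfl⟩)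
    have hind : Topology.IsInducing (Set.codRestrict φ Z hsub) :=
      (PrimeSpectrum.localization_comap_isInducing _ m.primeCompl).codRestrict hsub
    have := hind.topologicalKrullDim_le
    rwa [PrimeSpectrum.topologicalKrullDim_eq_ringKrullDim, hdim m] at this
  have hconn : ∀ p : PrimeSpectrum A,
      (d : WithBot ℕ∞) ≤ topologicalKrullDim (connectedComponent p) := fun p =>
    (hcomp _ (irreducibleComponent_mem_irreducibleComponents p)).trans
      (Topology.IsEmbedding.inclusion
        irreducibleComponent_subset_connectedComponent).isInducing.topologicalKrullDim_le
  refine ⟨fun Z hZ => ((topologicalKrullDim_subspace_le _ _).trans hle).antisymm (hcomp Z hZ),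
    fun p => ((topologicalKrullDim_subspace_le _ _).trans hle).antisymm (hconn p), fun _ => ?_⟩
  obtain ⟨p⟩ : Nonempty (PrimeSpectrum A) := inferInstance
  exact hle.antisymm ((hconn p).trans (topologicalKrullDim_subspace_le _ _))

end Dimension

section GroupWords

variable {G : Type*} [Group G]

theorem mu_succ {g : ℕ} (A B : Fin (g + 1) → G) :
    mu A B = A 0 * B 0 * (A 0)⁻¹ * (B 0)⁻¹ * mu (fun i => A i.succ) (fun i => B i.succ) := by
  simp [mu, List.ofFn_succ]

theorem mu_eq_one {G : Type*} [CommGroup G] {g : ℕ} (A B : Fin g → G) : mu A B = 1 := by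
  refine List.prod_eq_one fun x hx => ?_
  obtain ⟨i, rfl⟩ := (List.mem_ofFn' _ _).1 hx
  simp [mul_comm (A i) (B i)]

/-- The derivative of `μ` in an extension of `G` by a representation `V`: it is linear, and a linear
form vanishing on its image is invariant under all the `Aᵢ` and `Bᵢ`. -/
theorem exists_linearMap_mu {k V H : Type*} [Field k] [AddCommGroup V] [Module k V] [Group H]
    (s : G →* H) (ρ : G →* Module.End k V) (e : V → H) (he : ∀ v w, e (v + w) = e v * e w)
    (hse : ∀ a v, s a * e v = e (ρ a v) * s a) {g : ℕ} (A B : Fin g → G) :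
    ∃ T : ((Fin g → V) × (Fin g → V)) →ₗ[k] V,
      (∀ X Y, mu (fun i => e (X i) * s (A i)) (fun i => e (Y i) * s (B i)) =
        e (T (X, Y)) * s (mu A B)) ∧
      ∀ ℓ : V →ₗ[k] k, (∀ v, ℓ (T v) = 0) →
        ∀ i, (∀ v, ℓ (ρ (A i) v) = ℓ v) ∧ ∀ v, ℓ (ρ (B i) v) = ℓ v := by
  have he0 : e 0 = 1 := by
    have := he 0 0
    rw [add_zero] at this
    exact left_eq_mul.1 this
  induction g with
  | zero => exact ⟨0, fun X Y => by simp [mu, he0], fun _ _ i => i.elim0⟩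
  | succ g ih =>
    obtain ⟨T, hT, hinv⟩ := ih (fun i => A i.succ) (fun i => B i.succ)
    set a := A 0 with ha
    set b := B 0 with hb
    let x₀ : ((Fin (g + 1) → V) × (Fin (g + 1) → V)) →ₗ[k] V :=
      LinearMap.proj 0 ∘ₗ LinearMap.fst k _ _
    let y₀ : ((Fin (g + 1) → V) × (Fin (g + 1) → V)) →ₗ[k] V :=
      LinearMap.proj 0 ∘ₗ LinearMap.snd k _ _
    let tl : ((Fin (g + 1) → V) × (Fin (g + 1) → V)) →ₗ[k] ((Fin g → V) × (Fin g → V)) :=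
      (LinearMap.funLeft k V Fin.succ).prodMap (LinearMap.funLeft k V Fin.succ)
    let T' := x₀ + ρ a ∘ₗ y₀ - ρ (a * b * a⁻¹) ∘ₗ x₀ - ρ (a * b * a⁻¹ * b⁻¹) ∘ₗ y₀ +
      ρ (a * b * a⁻¹ * b⁻¹) ∘ₗ T ∘ₗ tl
    have hT' : ∀ X Y, T' (X, Y) = X 0 + ρ a (Y 0) - ρ (a * b * a⁻¹) (X 0) -
        ρ (a * b * a⁻¹ * b⁻¹) (Y 0) +
        ρ (a * b * a⁻¹ * b⁻¹) (T (fun i => X i.succ, fun i => Y i.succ)) := fun X Y => rfl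
    have hmul : ∀ c d v, ρ (c * d) v = ρ c (ρ d v) := fun c d v => by rw [map_mul]; rfl
    refine ⟨T', fun X Y => ?_, fun ℓ hℓ => ?_⟩
    · set Z := X 0 + ρ a (Y 0) - ρ (a * b * a⁻¹) (X 0) - ρ (a * b * a⁻¹ * b⁻¹) (Y 0) with hZ
      have hsm : ∀ v w x y, e v * s x * (e w * s y) = e (v + ρ x w) * s (x * y) := by
        intro v w x y
        rw [← mul_assoc, mul_assoc (e v), hse, ← mul_assoc, ← he, mul_assoc, map_mul]
      have h3 : e (X 0) * s a * (e (Y 0) * s b) * (e (X 0) * s a)⁻¹ * (e (Y 0) * s b)⁻¹ =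
          e Z * s (a * b * a⁻¹ * b⁻¹) := by
        rw [mul_inv_eq_iff_eq_mul, mul_inv_eq_iff_eq_mul, hsm, hsm, hsm, inv_mul_cancel_right,
          inv_mul_cancel_right]
        congr 2
        rw [hZ]
        abel
      rw [mu_succ, hT, h3, hT', mu_succ, hsm]
    · have hx : ∀ v, ℓ (ρ (a * b * a⁻¹) v) = ℓ v := fun v => by
        have h := hℓ (Fin.cons v 0, 0)
        rw [hT'] at h
        have h0 : ((fun i : Fin g => (Fin.cons v 0 : Fin (g + 1) → V) i.succ),
            fun i : Fin g => (0 : Fin (g + 1) → V) i.succ) = 0 := rfl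
        rw [h0] at h
        simp only [Fin.cons_zero, Pi.zero_apply, map_zero, add_zero, sub_zero, map_sub] at h
        exact (sub_eq_zero.1 h).symm
      have hy : ∀ v, ℓ (ρ a v) = ℓ (ρ b⁻¹ v) := fun v => by
        have h := hℓ (0, Fin.cons v 0)
        rw [hT'] at h
        have h0 : ((fun i : Fin g => (0 : Fin (g + 1) → V) i.succ),
            fun i : Fin g => (Fin.cons v 0 : Fin (g + 1) → V) i.succ) = 0 := rfl
        rw [h0] at h
        simp only [Fin.cons_zero, Pi.zero_apply, map_zero, zero_add, add_zero, sub_zero, map_sub]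
          at h
        rw [sub_eq_zero.1 h, hmul, hx]
      have hab : ∀ v, ℓ (ρ (a * b) v) = ℓ v := fun v => by
        rw [hmul, hy, ← hmul, inv_mul_cancel, map_one]
        rfl
      have ha' : ∀ v, ℓ (ρ a v) = ℓ v := fun v => by
        have h := hx (ρ a v)
        rw [← hmul, inv_mul_cancel_right, hab] at h
        exact h.symm
      have hb' : ∀ v, ℓ (ρ b v) = ℓ v := fun v => by rw [← ha', ← hmul, hab]
      have hab' : ∀ v, ℓ (ρ (a * b * a⁻¹ * b⁻¹) v) = ℓ v := fun v => by
        rw [hmul, hx, ← hb', ← hmul, mul_inv_cancel, map_one]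
        rfl
      have htl := hinv ℓ fun v => by
        have h := hℓ (Fin.cons 0 v.1, Fin.cons 0 v.2)
        rw [hT'] at h
        simp only [Fin.cons_zero, Fin.cons_succ, map_zero, add_zero, sub_zero, zero_add] at h
        rwa [hab'] at h
      exact fun i => Fin.cases ⟨ha', hb'⟩ htl i

end GroupWords

section SymplecticLieAlgebra

variable {K : Type*} [Field K] {n : ℕ}

/-- The Lie algebra of the symplectic group: the matrices `Z` for which `J Z` is symmetric. -/
def sp (K : Type*) [Field K] (n : ℕ) : Submodule K (Matrix (Fin n ⊕ Fin n) (Fin n ⊕ Fin n) K) where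
  carrier := {Z | (J (Fin n) K * Z)ᵀ = J (Fin n) K * Z}
  add_mem' {Z W} hZ hW := by
    change (J (Fin n) K * (Z + W))ᵀ = J (Fin n) K * (Z + W)
    rw [Matrix.mul_add, transpose_add]
    exact congrArg₂ _ hZ hW
  zero_mem' := by simp
  smul_mem' c Z hZ := by
    change (J (Fin n) K * (c • Z))ᵀ = J (Fin n) K * (c • Z)
    rw [Matrix.mul_smul, transpose_smul]
    exact congrArg _ hZ

theorem mem_sp_iff {Z : Matrix (Fin n ⊕ Fin n) (Fin n ⊕ Fin n) K} :
    Z ∈ sp K n ↔ (J (Fin n) K * Z)ᵀ = J (Fin n) K * Z := Iff.rfl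

theorem transpose_mul_J_of_mem_sp {Z : Matrix (Fin n ⊕ Fin n) (Fin n ⊕ Fin n) K}
    (hZ : Z ∈ sp K n) : Zᵀ * J (Fin n) K = -(J (Fin n) K * Z) := by
  have h := mem_sp_iff.1 hZ
  rw [transpose_mul, J_transpose, Matrix.mul_neg] at h
  rw [← h, neg_neg]

theorem J_mul_coe (A : symplecticGroup (Fin n) K) :
    J (Fin n) K * A.1 = (A⁻¹).1ᵀ * J (Fin n) K := by
  have h1 := SymplecticGroup.mem_iff'.1 A.2
  have h2 : (A⁻¹).1ᵀ * A.1ᵀ = 1 := by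
    rw [← transpose_mul, ← Submonoid.coe_mul, mul_inv_cancel]
    simp
  nth_rw 2 [← h1]
  rw [← Matrix.mul_assoc, ← Matrix.mul_assoc, h2, Matrix.one_mul]

theorem conj_mem_sp (A : symplecticGroup (Fin n) K)
    {Z : Matrix (Fin n ⊕ Fin n) (Fin n ⊕ Fin n) K} (hZ : Z ∈ sp K n) :
    A.1 * Z * (A⁻¹).1 ∈ sp K n := by
  rw [mem_sp_iff, ← Matrix.mul_assoc, ← Matrix.mul_assoc, J_mul_coe, Matrix.mul_assoc _ _ Z,
    transpose_mul, transpose_mul, mem_sp_iff.1 hZ, transpose_transpose]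
  simp only [Matrix.mul_assoc]

/-- The adjoint representation of the symplectic group. -/
def Ad (K : Type*) [Field K] (n : ℕ) : symplecticGroup (Fin n) K →* Module.End K (sp K n) where
  toFun A :=
    { toFun := fun Z => ⟨A.1 * Z.1 * (A⁻¹).1, conj_mem_sp A Z.2⟩
      map_add' := fun Z W => Subtype.ext (by simp [Matrix.mul_add, Matrix.add_mul])
      map_smul' := fun c Z => Subtype.ext (by simp) }
  map_one' := by
    ext1 Z
    exact Subtype.ext (by simp)
  map_mul' A B := by
    ext1 Z
    refine Subtype.ext ?_
    simp [_root_.mul_inv_rev, Matrix.mul_assoc]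

theorem coe_Ad (A : symplecticGroup (Fin n) K) (Z : sp K n) :
    (Ad K n A Z).1 = A.1 * Z.1 * (A⁻¹).1 := rfl

theorem trace_mul_reflect {W : Matrix (Fin n ⊕ Fin n) (Fin n ⊕ Fin n) K} (hW : W ∈ sp K n)
    (Q : Matrix (Fin n ⊕ Fin n) (Fin n ⊕ Fin n) K) :
    (W * (J (Fin n) K * Qᵀ * J (Fin n) K)).trace = (W * Q).trace := by
  have h := transpose_mul_J_of_mem_sp hW
  calc (W * (J (Fin n) K * Qᵀ * J (Fin n) K)).trace
      = ((J (Fin n) K * W * J (Fin n) K) * Qᵀ).trace := by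
        rw [← Matrix.mul_assoc, Matrix.trace_mul_comm, ← Matrix.mul_assoc, ← Matrix.mul_assoc]
    _ = (Wᵀ * Qᵀ).trace := by
        rw [← neg_neg (J (Fin n) K * W), ← h, Matrix.neg_mul, Matrix.mul_assoc, J_squared]
        simp
    _ = (W * Q).trace := by rw [← transpose_mul, trace_transpose, Matrix.trace_mul_comm]

theorem add_reflect_mem_sp (Q : Matrix (Fin n ⊕ Fin n) (Fin n ⊕ Fin n) K) :
    Q + J (Fin n) K * Qᵀ * J (Fin n) K ∈ sp K n := by
  rw [mem_sp_iff, Matrix.mul_add, ← Matrix.mul_assoc, ← Matrix.mul_assoc, J_squared]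
  simp [transpose_mul, add_comm]

theorem eq_zero_of_trace_mul_eq_zero (h2 : (2 : K) ≠ 0)
    {W : Matrix (Fin n ⊕ Fin n) (Fin n ⊕ Fin n) K} (hW : W ∈ sp K n)
    (h : ∀ Z ∈ sp K n, (W * Z).trace = 0) : W = 0 := by
  ext i j
  have h1 := h _ (add_reflect_mem_sp (Matrix.single j i 1))
  rw [Matrix.mul_add, trace_add, trace_mul_reflect hW, ← two_mul] at h1
  have h3 := (mul_eq_zero.1 h1).resolve_left h2
  simpa [Matrix.trace_mul_single] using h3

/-- Every linear form on the symplectic Lie algebra is given by the trace form. -/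
theorem exists_trace_mul_eq (h2 : (2 : K) ≠ 0) (ℓ : sp K n →ₗ[K] K) :
    ∃ W ∈ sp K n, ∀ Z : sp K n, ℓ Z = (W * Z.1).trace := by
  obtain ⟨l, hl⟩ := LinearMap.exists_extend ℓ
  let Q : Matrix (Fin n ⊕ Fin n) (Fin n ⊕ Fin n) K := Matrix.of fun j i => l (Matrix.single i j 1)
  have hQ : ∀ Z, l Z = (Q * Z).trace := by
    intro Z
    conv_lhs => rw [Matrix.matrix_eq_sum_single Z]
    simp only [map_sum, Matrix.trace, Matrix.diag, Matrix.mul_apply]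
    rw [Finset.sum_comm]
    refine Finset.sum_congr rfl fun j _ => Finset.sum_congr rfl fun i _ => ?_
    have : Matrix.single i j (Z i j) = Z i j • Matrix.single i j (1 : K) := by simp
    rw [this, map_smul, smul_eq_mul, mul_comm]
    rfl
  refine ⟨(2 : K)⁻¹ • (Q + J (Fin n) K * Qᵀ * J (Fin n) K),
    (sp K n).smul_mem _ (add_reflect_mem_sp Q), fun Z => ?_⟩
  have h3 : ℓ Z = l Z.1 := by rw [← hl]; rfl
  rw [Matrix.smul_mul, trace_smul, Matrix.trace_mul_comm, Matrix.mul_add, trace_add,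
    trace_mul_reflect Z.2, h3, hQ, Matrix.trace_mul_comm, smul_eq_mul, ← two_mul,
    inv_mul_cancel_left₀ h2]

end SymplecticLieAlgebra

section Generic

variable {K : Type*} [Field K] {n : ℕ}

theorem eq_of_xi_eq {φ : K} (hφ : φ ≠ 0) {k : Fin n → ℕ} (hk : Generic φ k) {a b : Fin n ⊕ Fin n}
    (h : (Sum.elim (fun i => φ ^ k i) (fun i => (φ ^ k i)⁻¹) a : K) =
      Sum.elim (fun i => φ ^ k i) (fun i => (φ ^ k i)⁻¹) b) : a = b := by
  have h1 : ∀ i j, φ ^ k i = φ ^ k j → i = j := by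
    intro i j hij
    by_contra hne
    exact hk.1 {i} {j} (by simpa using hne) (Or.inl (Finset.singleton_nonempty i)) (by simpa)
  have h2 : ∀ i j, φ ^ k i ≠ (φ ^ k j)⁻¹ := by
    intro i j hij
    have hm : φ ^ k i * φ ^ k j = 1 := by rw [hij, inv_mul_cancel₀ (pow_ne_zero _ hφ)]
    by_cases hne : i = j
    · subst hne
      exact hk.2 i (by rw [two_mul, pow_add, hm])
    · exact hk.1 {i, j} ∅ (by simp) (Or.inl ⟨i, by simp⟩) (by simp [Finset.prod_pair hne, hm])
  rcases a with i | i <;> rcases b with j | j <;> simp only [Sum.elim_inl, Sum.elim_inr] at h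
  · rw [h1 i j h]
  · exact absurd h (h2 i j)
  · exact absurd h.symm (h2 j i)
  · rw [h1 i j (inv_injective h)]

/-- If symplectic matrices commute with an idempotent `E`, then so does the product of their
commutators, and it has determinant `1` on the image of `E`. -/
theorem det_mu_mul_idempotent {g : ℕ} (A B : Fin g → symplecticGroup (Fin n) K)
    {E : Matrix (Fin n ⊕ Fin n) (Fin n ⊕ Fin n) K} (hE : E * E = E)
    (hA : ∀ i, (A i).1 * E = E * (A i).1) (hB : ∀ i, (B i).1 * E = E * (B i).1) :
    ((mu A B).1 * E + (1 - E)).det = 1 := by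
  let C : Subgroup (symplecticGroup (Fin n) K) :=
    { carrier := {X | X.1 * E = E * X.1}
      one_mem' := by simp
      mul_mem' := fun {X Y} hX hY => by
        change X.1 * Y.1 * E = E * (X.1 * Y.1)
        rw [Matrix.mul_assoc, show Y.1 * E = E * Y.1 from hY, ← Matrix.mul_assoc,
          show X.1 * E = E * X.1 from hX, Matrix.mul_assoc]
      inv_mem' := fun {X} hX => by
        have h1 : (X⁻¹).1 * X.1 = 1 := by rw [← Submonoid.coe_mul, inv_mul_cancel]; rfl
        have h2 : X.1 * (X⁻¹).1 = 1 := by rw [← Submonoid.coe_mul, mul_inv_cancel]; rfl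
        change (X⁻¹).1 * E = E * (X⁻¹).1
        calc (X⁻¹).1 * E = (X⁻¹).1 * (E * X.1) * (X⁻¹).1 := by
              rw [Matrix.mul_assoc, Matrix.mul_assoc E, h2, Matrix.mul_one]
          _ = E * (X⁻¹).1 := by
              rw [← show X.1 * E = E * X.1 from hX, ← Matrix.mul_assoc, h1, Matrix.one_mul] }
  let χ : C →* K :=
    { toFun := fun X => (X.1.1 * E + (1 - E)).det
      map_one' := by simp
      map_mul' := fun X Y => by
        rw [← det_mul]
        congr 1
        have hY : Y.1.1 * E = E * Y.1.1 := Y.2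
        have h1 : E * (1 - E) = 0 := by rw [Matrix.mul_sub, hE, Matrix.mul_one, sub_self]
        have h2 : (1 - E) * E = 0 := by rw [Matrix.sub_mul, hE, Matrix.one_mul, sub_self]
        have h3 : (1 - E) * (1 - E) = 1 - E := by
          rw [Matrix.mul_sub, h2, Matrix.mul_one, sub_zero]
        rw [Matrix.add_mul, Matrix.mul_add, Matrix.mul_add, h3, hY, ← Matrix.mul_assoc (1 - E), h2,
          Matrix.zero_mul, ← hY, Matrix.mul_assoc X.1.1 E (1 - E), h1, Matrix.mul_zero, add_zero,
          zero_add, hY, ← Matrix.mul_assoc, Matrix.mul_assoc X.1.1 E E, hE, Matrix.mul_assoc X.1.1,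
          ← hY, ← Matrix.mul_assoc]
        rfl }
  let A' : Fin g → C := fun i => ⟨A i, hA i⟩
  let B' : Fin g → C := fun i => ⟨B i, hB i⟩
  have h1 : (mu A' B').1 = mu A B := map_mu C.subtype A' B'
  have h2 : χ (mu A' B') = 1 := by
    rw [← MonoidHom.coe_toHomUnits, map_mu, mu_eq_one, Units.val_one]
  rw [← h1]
  exact h2

/-- Only `0` in the symplectic Lie algebra commutes with symplectic matrices `Aᵢ`, `Bᵢ` whose
commutators have product `ξ`. -/
theorem eq_zero_of_commute {φ : K} (hφ : φ ≠ 0) (h2 : (2 : K) ≠ 0) {k : Fin n → ℕ}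
    (hk : Generic φ k) {g : ℕ} {A B : Fin g → symplecticGroup (Fin n) K}
    (hAB : (mu A B).1 = xi φ k) {W : Matrix (Fin n ⊕ Fin n) (Fin n ⊕ Fin n) K} (hW : W ∈ sp K n)
    (hA : ∀ i, (A i).1 * W = W * (A i).1) (hB : ∀ i, (B i).1 * W = W * (B i).1) : W = 0 := by
  have hcomm : (mu A B).1 * W = W * (mu A B).1 := by
    have hmem : ∀ X ∈ (List.ofFn fun i => A i * B i * (A i)⁻¹ * (B i)⁻¹),
        X.1 * W = W * X.1 := by
      intro X hX
      obtain ⟨i, rfl⟩ := List.mem_ofFn.1 hX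
      have hinv : ∀ X : symplecticGroup (Fin n) K, Commute X.1 W → Commute (X⁻¹).1 W := by
        intro X hX
        have h1 : (X⁻¹).1 * X.1 = 1 := by rw [← Submonoid.coe_mul, inv_mul_cancel]; rfl
        have h2 : X.1 * (X⁻¹).1 = 1 := by rw [← Submonoid.coe_mul, mul_inv_cancel]; rfl
        let u : (Matrix (Fin n ⊕ Fin n) (Fin n ⊕ Fin n) K)ˣ := ⟨X.1, (X⁻¹).1, h2, h1⟩
        exact (Commute.units_inv_left_iff (u := u)).2 hX
      have ha : Commute (A i).1 W := hA i
      have hb : Commute (B i).1 W := hB i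
      exact ((ha.mul_left hb).mul_left (hinv _ ha)).mul_left (hinv _ hb)
    have hprod : ∀ L : List (symplecticGroup (Fin n) K), (∀ X ∈ L, X.1 * W = W * X.1) →
        Commute L.prod.1 W := by
      intro L
      induction L with
      | nil => exact fun _ => Commute.one_left W
      | cons X L ih =>
        intro hL
        rw [List.prod_cons]
        exact Commute.mul_left (hL X (by simp)) (ih fun Y hY => hL Y (by simp [hY]))
    exact hprod _ hmem
  have hdiag : ∀ a b, a ≠ b → W a b = 0 := by
    intro a b hab
    have h := congrFun (congrFun (hAB ▸ hcomm) a) b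
    rw [xi, Matrix.diagonal_mul, Matrix.mul_diagonal, mul_comm (W a b), ← sub_eq_zero,
      ← sub_mul] at h
    exact (mul_eq_zero.1 h).resolve_left fun h => hab (eq_of_xi_eq hφ hk (sub_eq_zero.1 h))
  set w : Fin n ⊕ Fin n → K := fun a => W a a with hw
  have hWd : W = Matrix.diagonal w := by
    ext a b
    by_cases hab : a = b
    · subst hab
      simp [hw]
    · rw [hdiag a b hab, Matrix.diagonal_apply_ne _ hab]
  have hneg : ∀ i, w (Sum.inr i) = - w (Sum.inl i) := by
    intro i
    have h := congrFun (congrFun (mem_sp_iff.1 hW) (Sum.inl i)) (Sum.inr i)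
    rw [transpose_apply, hWd, Matrix.mul_diagonal, Matrix.mul_diagonal] at h
    simp only [J, fromBlocks_apply₂₁, fromBlocks_apply₁₂, Matrix.neg_apply, one_apply_eq, one_mul,
      neg_mul] at h
    rw [h, neg_neg]
  by_contra hne
  obtain ⟨i₀, hi₀⟩ : ∃ i, w (Sum.inl i) ≠ 0 := by
    by_contra! hall
    refine hne ?_
    rw [hWd, Matrix.diagonal_eq_zero]
    funext a
    rcases a with i | i
    · exact hall i
    · rw [hneg, hall]
      simp
  set c := w (Sum.inl i₀) with hc
  classical
  let E : Matrix (Fin n ⊕ Fin n) (Fin n ⊕ Fin n) K :=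
    Matrix.diagonal fun a => if w a = c then 1 else 0
  have hE : E * E = E := by
    simp only [E, Matrix.diagonal_mul_diagonal]
    congr 1
    funext a
    split_ifs <;> simp
  have hcommE : ∀ X : Matrix (Fin n ⊕ Fin n) (Fin n ⊕ Fin n) K, X * W = W * X →
      X * E = E * X := by
    intro X hX
    ext a b
    have h := congrFun (congrFun hX a) b
    rw [hWd, Matrix.mul_diagonal, Matrix.diagonal_mul, mul_comm, ← sub_eq_zero, ← sub_mul] at h
    rw [Matrix.mul_diagonal, Matrix.diagonal_mul, mul_comm]
    rcases mul_eq_zero.1 h with h | h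
    · rw [sub_eq_zero.1 h]
    · rw [h, mul_zero, mul_zero]
  have hdet := det_mu_mul_idempotent A B hE (fun i => hcommE _ (hA i)) fun i => hcommE _ (hB i)
  rw [hAB, xi, Matrix.diagonal_mul_diagonal, ← Matrix.diagonal_one, Matrix.diagonal_sub,
    Matrix.diagonal_add, Matrix.det_diagonal, Fintype.prod_sum_type] at hdet
  have hL : ∀ i, (w (Sum.inr i) = c ↔ w (Sum.inl i) = -c) := by
    intro i
    rw [hneg, neg_eq_iff_eq_neg]
  have e1 : ∀ i : Fin n, (Sum.elim (fun i => φ ^ k i) (fun i => (φ ^ k i)⁻¹) (Sum.inl i : Fin n ⊕ Fin n) *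
      (if w (Sum.inl i) = c then 1 else 0) + (1 - if w (Sum.inl i) = c then 1 else 0) : K) =
      if w (Sum.inl i) = c then φ ^ k i else 1 := by
    intro i
    split_ifs <;> simp
  have e2 : ∀ i : Fin n, (Sum.elim (fun i => φ ^ k i) (fun i => (φ ^ k i)⁻¹) (Sum.inr i : Fin n ⊕ Fin n) *
      (if w (Sum.inr i) = c then 1 else 0) + (1 - if w (Sum.inr i) = c then 1 else 0) : K) =
      if w (Sum.inl i) = -c then (φ ^ k i)⁻¹ else 1 := by
    intro i
    simp only [hL]
    split_ifs <;> simp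
  simp only [e1, e2] at hdet
  rw [← Finset.prod_filter, ← Finset.prod_filter, Finset.prod_inv_distrib,
    ← div_eq_mul_inv, div_eq_one_iff_eq (Finset.prod_ne_zero_iff.2 fun i _ => pow_ne_zero _ hφ)]
    at hdet
  refine hk.1 _ _ ?_ (Or.inl ⟨i₀, by simp [hc]⟩) hdet
  rw [Finset.disjoint_left]
  intro i hi hi'
  have h3 := (Finset.mem_filter.1 hi).2.symm.trans (Finset.mem_filter.1 hi').2
  have h4 : 2 * c = 0 := by
    rw [two_mul]
    nth_rw 1 [h3]
    simp
  exact hi₀ ((mul_eq_zero.1 h4).resolve_left h2)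

end Generic

noncomputable section

section DualNumbers

variable {K : Type*} [Field K] {n : ℕ} {ι : Type*}

/-- The matrix `A + ε X` over the dual numbers. -/
def dual (A X : Matrix ι ι K) : Matrix ι ι (DualNumber K) :=
  Matrix.of fun i j => TrivSqZeroExt.inl (A i j) + TrivSqZeroExt.inr (X i j)

theorem fst_dual (A X : Matrix ι ι K) (i j : ι) : (dual A X i j).fst = A i j := by
  simp [dual]

theorem snd_dual (A X : Matrix ι ι K) (i j : ι) : (dual A X i j).snd = X i j := by
  simp [dual]

theorem dual_ext {R : Type*} {M N : Matrix ι ι (DualNumber R)} (h1 : ∀ i j, (M i j).fst = (N i j).fst)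
    (h2 : ∀ i j, (M i j).snd = (N i j).snd) : M = N := by
  ext1 i j
  exact TrivSqZeroExt.ext (h1 i j) (h2 i j)

theorem dual_mul [Fintype ι] (A X B Y : Matrix ι ι K) :
    dual A X * dual B Y = dual (A * B) (A * Y + X * B) := by
  refine dual_ext (fun i j => ?_) fun i j => ?_
  · rw [fst_dual, Matrix.mul_apply, Matrix.mul_apply, TrivSqZeroExt.fst_sum]
    simp [fst_dual]
  · rw [snd_dual, Matrix.mul_apply, Matrix.add_apply, Matrix.mul_apply, Matrix.mul_apply,
      TrivSqZeroExt.snd_sum, ← Finset.sum_add_distrib]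
    simp [fst_dual, snd_dual]

theorem transpose_dual (A X : Matrix ι ι K) : (dual A X)ᵀ = dual Aᵀ Xᵀ := rfl

theorem map_inl_eq_dual (A : Matrix ι ι K) :
    A.map (TrivSqZeroExt.inlHom K K) = dual A 0 := by
  refine dual_ext (fun i j => ?_) fun i j => ?_
  · simp [fst_dual]
  · simp [snd_dual]

theorem J_eq_dual : J (Fin n) (DualNumber K) = dual (J (Fin n) K) 0 := by
  rw [← map_inl_eq_dual]
  exact (map_J (Fin n) (TrivSqZeroExt.inlHom K K)).symm

theorem dual_inj {A X B Y : Matrix ι ι K} : dual A X = dual B Y ↔ A = B ∧ X = Y := by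
  refine ⟨fun h => ⟨?_, ?_⟩, fun h => by rw [h.1, h.2]⟩
  · ext i j
    rw [← fst_dual A X, h, fst_dual]
  · ext i j
    rw [← snd_dual A X, h, snd_dual]

theorem dual_one_mem_iff {Z : Matrix (Fin n ⊕ Fin n) (Fin n ⊕ Fin n) K} :
    dual 1 Z ∈ symplecticGroup (Fin n) (DualNumber K) ↔ Z ∈ sp K n := by
  rw [SymplecticGroup.mem_iff', J_eq_dual, transpose_dual, dual_mul, dual_mul, dual_inj,
    mem_sp_iff, transpose_mul, J_transpose]
  simp [add_eq_zero_iff_eq_neg, eq_comm]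

/-- The element `1 + ε Z` of the symplectic group over the dual numbers. -/
def spExp (Z : sp K n) : symplecticGroup (Fin n) (DualNumber K) :=
  ⟨dual 1 Z.1, dual_one_mem_iff.2 Z.2⟩

theorem spExp_add (Z W : sp K n) : spExp (Z + W) = spExp Z * spExp W :=
  Subtype.ext (by simp [spExp, dual_mul, add_comm])

theorem spHom_inl_mul_spExp (A : symplecticGroup (Fin n) K) (Z : sp K n) :
    spHom n (TrivSqZeroExt.inlHom K K) A * spExp Z =
      spExp (Ad K n A Z) * spHom n (TrivSqZeroExt.inlHom K K) A := by
  have h : (A⁻¹).1 * A.1 = 1 := by rw [← Submonoid.coe_mul, inv_mul_cancel]; rfl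
  refine Subtype.ext ?_
  change A.1.map (TrivSqZeroExt.inlHom K K) * dual 1 Z.1 =
    dual 1 (A.1 * Z.1 * (A⁻¹).1) * A.1.map (TrivSqZeroExt.inlHom K K)
  rw [map_inl_eq_dual, dual_mul, dual_mul, Matrix.mul_assoc _ _ A.1, h]
  simp

theorem spHom_fst_inl (A : symplecticGroup (Fin n) K) :
    spHom n (TrivSqZeroExt.fstHom K K K).toRingHom
      (spHom n (TrivSqZeroExt.inlHom K K) A) = A := by
  refine Subtype.ext ?_
  ext i j
  simp [spHom, spMap]

theorem spHom_fst_spExp (Z : sp K n) :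
    spHom n (TrivSqZeroExt.fstHom K K K).toRingHom (spExp Z) = 1 := by
  refine Subtype.ext ?_
  ext i j
  exact fst_dual _ _ i j

theorem exists_spExp_mul (A : symplecticGroup (Fin n) K) (X : Tangent A) :
    ∃ Z : sp K n, X.1 = spExp Z * spHom n (TrivSqZeroExt.inlHom K K) A := by
  set N := X.1 * (spHom n (TrivSqZeroExt.inlHom K K) A)⁻¹ with hN
  have h1 : spHom n (TrivSqZeroExt.fstHom K K K).toRingHom N = 1 := by
    rw [hN, map_mul, map_inv, spHom_fst_inl, X.2, mul_inv_cancel]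
  have h2 : N.1 = dual 1 (N.1.map TrivSqZeroExt.snd) := by
    refine dual_ext (fun i j => ?_) fun i j => ?_
    · rw [fst_dual]
      exact congrFun (congrFun (congrArg Subtype.val h1) i) j
    · rw [snd_dual]
      rfl
  refine ⟨⟨N.1.map TrivSqZeroExt.snd, dual_one_mem_iff.1 (h2 ▸ N.2)⟩, ?_⟩
  rw [← mul_inv_eq_iff_eq_mul, ← hN]
  exact Subtype.ext h2

end DualNumbers

section Surjectivity

variable {K : Type*} [Field K] {n g : ℕ}

/-- The element `(1 + ε Z) A` of the tangent space at `A`. -/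
def tangentMk (A : symplecticGroup (Fin n) K) (Z : sp K n) : Tangent A :=
  ⟨spExp Z * spHom n (TrivSqZeroExt.inlHom K K) A, by
    rw [map_mul, spHom_fst_spExp, spHom_fst_inl, one_mul]⟩

theorem dmu_surjective (h2 : (2 : K) ≠ 0) {φ : K} (hφ : φ ≠ 0) {k : Fin n → ℕ}
    (hk : Generic φ k) {A B : Fin g → symplecticGroup (Fin n) K} (hAB : (mu A B).1 = xi φ k) :
    Function.Surjective (dmu A B) := by
  obtain ⟨T, hT, hinv⟩ := exists_linearMap_mu (spHom n (TrivSqZeroExt.inlHom K K)) (Ad K n) spExp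
    spExp_add spHom_inl_mul_spExp A B
  have hsurj : Function.Surjective T := by
    rw [← LinearMap.range_eq_top]
    by_contra hne
    obtain ⟨ℓ, hℓ, hle⟩ := Submodule.exists_le_ker_of_lt_top _ (lt_top_iff_ne_top.2 hne)
    obtain ⟨W, hW, hWℓ⟩ := exists_trace_mul_eq h2 ℓ
    have hcomm : ∀ X : symplecticGroup (Fin n) K, (∀ v, ℓ (Ad K n X v) = ℓ v) →
        X.1 * W = W * X.1 := by
      intro X hX
      have h3 : (Ad K n X⁻¹ ⟨W, hW⟩).1 - W = 0 := by
        refine eq_zero_of_trace_mul_eq_zero h2 ((sp K n).sub_mem (Subtype.prop _) hW)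
          fun Z hZ => ?_
        have h4 := hX ⟨Z, hZ⟩
        rw [hWℓ, hWℓ, coe_Ad, ← Matrix.mul_assoc, ← Matrix.mul_assoc, Matrix.trace_mul_comm,
          ← Matrix.mul_assoc, ← Matrix.mul_assoc] at h4
        rw [coe_Ad, inv_inv, Matrix.sub_mul, trace_sub, h4, sub_self]
      have h5 : X.1 * (X⁻¹).1 = 1 := by rw [← Submonoid.coe_mul, mul_inv_cancel]; rfl
      rw [coe_Ad, inv_inv, sub_eq_zero] at h3
      nth_rw 1 [← h3]
      rw [← Matrix.mul_assoc, ← Matrix.mul_assoc, h5, Matrix.one_mul]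
    have hℓ0 := hinv ℓ fun v => hle ⟨v, rfl⟩
    have hW0 := eq_zero_of_commute hφ h2 hk hAB hW (fun i => hcomm _ (hℓ0 i).1)
      fun i => hcomm _ (hℓ0 i).2
    refine hℓ (LinearMap.ext fun Z => ?_)
    rw [hWℓ, hW0]
    simp
  intro t
  obtain ⟨Z, hZ⟩ := exists_spExp_mul _ t
  obtain ⟨⟨X, Y⟩, rfl⟩ := hsurj Z
  refine ⟨⟨fun i => tangentMk _ (X i), fun i => tangentMk _ (Y i)⟩, Subtype.ext ?_⟩
  rw [hZ, ← hT]
  rfl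

end Surjectivity

section Equations

/-- The `i`-th matrix of a tuple of matrices given by its entries. -/
def entryMat {R : Type*} {g n : ℕ} (x : Entry g n → R) (i : Fin g ⊕ Fin g) :
    Matrix (Fin n ⊕ Fin n) (Fin n ⊕ Fin n) R :=
  Matrix.of fun a b => x (i, a, b)

/-- The adjoint of a matrix for the symplectic form: the inverse of a symplectic matrix. -/
def sympAdj {R : Type*} [CommRing R] {n : ℕ} (X : Matrix (Fin n ⊕ Fin n) (Fin n ⊕ Fin n) R) :
    Matrix (Fin n ⊕ Fin n) (Fin n ⊕ Fin n) R :=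
  -J (Fin n) R * Xᵀ * J (Fin n) R

/-- The product of the commutators of a tuple of matrices, with the inverses replaced by the adjoints
for the symplectic form. -/
def commProd {R : Type*} [CommRing R] {g n : ℕ} (x : Entry g n → R) :
    Matrix (Fin n ⊕ Fin n) (Fin n ⊕ Fin n) R :=
  (List.ofFn fun i : Fin g => entryMat x (Sum.inl i) * entryMat x (Sum.inr i) *
    sympAdj (entryMat x (Sum.inl i)) * sympAdj (entryMat x (Sum.inr i))).prod

/-- Pairs of indices above the diagonal. -/
abbrev StrictPair (n : ℕ) : Type :=
  {p : (Fin n ⊕ Fin n) × (Fin n ⊕ Fin n) // finSumFinEquiv p.1 < finSumFinEquiv p.2}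

/-- Pairs of indices on or above the diagonal. -/
abbrev WeakPair (n : ℕ) : Type :=
  {p : (Fin n ⊕ Fin n) × (Fin n ⊕ Fin n) // finSumFinEquiv p.1 ≤ finSumFinEquiv p.2}

/-- Indices for the local equations of the variety. -/
abbrev EqIndex (g n : ℕ) : Type := ((Fin g ⊕ Fin g) × StrictPair n) ⊕ WeakPair n

/-- Local equations of the variety: the matrices are symplectic, and `M = μ ξ⁻¹` satisfies
`J M + (J M)ᵀ = 0`, that is `M = M⁻¹`. Here `C` stands for `ξ⁻¹`. -/
def eqns {R : Type*} [CommRing R] {g n : ℕ} (C : Matrix (Fin n ⊕ Fin n) (Fin n ⊕ Fin n) R)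
    (x : Entry g n → R) : EqIndex g n → R :=
  Sum.elim
    (fun j => ((entryMat x j.1)ᵀ * J (Fin n) R * entryMat x j.1 - J (Fin n) R) j.2.1.1 j.2.1.2)
    (fun j => (J (Fin n) R * (commProd x * C) + (J (Fin n) R * (commProd x * C))ᵀ) j.1.1 j.1.2)

/-- The determinant of `M + 1` for `M = μ ξ⁻¹`. -/
def detAddOne {R : Type*} [CommRing R] {g n : ℕ} (C : Matrix (Fin n ⊕ Fin n) (Fin n ⊕ Fin n) R)
    (x : Entry g n → R) : R :=
  (commProd x * C + 1).det

variable {R S : Type*} [CommRing R] [CommRing S] (f : R →+* S) {g n : ℕ}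

theorem map_sympAdj (X : Matrix (Fin n ⊕ Fin n) (Fin n ⊕ Fin n) R) :
    f.mapMatrix (sympAdj X) = sympAdj (f.mapMatrix X) := by
  have hJ : f.mapMatrix (J (Fin n) R) = J (Fin n) S := map_J _ f
  rw [sympAdj, sympAdj, map_mul, map_mul, map_neg, hJ]
  rfl

theorem map_commProd (x : Entry g n → R) :
    f.mapMatrix (commProd x) = commProd fun e => f (x e) := by
  have he : ∀ i, f.mapMatrix (entryMat x i) = entryMat (fun e => f (x e)) i := fun i => rfl
  rw [commProd, commProd, map_list_prod, List.map_ofFn]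
  simp only [Function.comp_def, map_mul, map_sympAdj, he]

theorem map_eqns (C : Matrix (Fin n ⊕ Fin n) (Fin n ⊕ Fin n) R) (x : Entry g n → R)
    (j : EqIndex g n) : f (eqns C x j) = eqns (f.mapMatrix C) (fun e => f (x e)) j := by
  have hJ : f.mapMatrix (J (Fin n) R) = J (Fin n) S := map_J _ f
  have he : ∀ i, f.mapMatrix (entryMat x i) = entryMat (fun e => f (x e)) i := fun i => rfl
  have ht : ∀ X : Matrix (Fin n ⊕ Fin n) (Fin n ⊕ Fin n) R,
    f.mapMatrix Xᵀ = (f.mapMatrix X)ᵀ := fun X => rfl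
  rcases j with ⟨i, p⟩ | p
  · change f.mapMatrix ((entryMat x i)ᵀ * J (Fin n) R * entryMat x i - J (Fin n) R) p.1.1 p.1.2 = _
    rw [map_sub, map_mul, map_mul, ht, he, hJ]
    rfl
  · change f.mapMatrix (J (Fin n) R * (commProd x * C) + (J (Fin n) R * (commProd x * C))ᵀ)
      p.1.1 p.1.2 = _
    rw [map_add, ht, map_mul, map_mul, hJ, map_commProd]
    rfl

theorem map_detAddOne (C : Matrix (Fin n ⊕ Fin n) (Fin n ⊕ Fin n) R) (x : Entry g n → R) :
    f (detAddOne C x) = detAddOne (f.mapMatrix C) fun e => f (x e) := by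
  rw [detAddOne, detAddOne, RingHom.map_det, map_add, map_mul, map_one, map_commProd]

theorem commProd_eq_mu {x : Entry g n → R} (A B : Fin g → symplecticGroup (Fin n) R)
    (hA : ∀ i, entryMat x (Sum.inl i) = (A i).1) (hB : ∀ i, entryMat x (Sum.inr i) = (B i).1) :
    commProd x = (mu A B).1 := by
  have h := map_list_prod (symplecticGroup (Fin n) R).subtype
    (List.ofFn fun i => A i * B i * (A i)⁻¹ * (B i)⁻¹)
  rw [List.map_ofFn] at h
  refine Eq.trans ?_ h.symm
  rw [commProd]
  simp only [hA, hB]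
  rfl

end Equations

section ZeroLocus

variable {K : Type*} [Field K] {g n : ℕ}

theorem eq_zero_of_transpose_eq_neg (h2 : (2 : K) ≠ 0)
    {Q : Matrix (Fin n ⊕ Fin n) (Fin n ⊕ Fin n) K} (hQ : Qᵀ = -Q)
    (h : ∀ p : StrictPair n, Q p.1.1 p.1.2 = 0) : Q = 0 := by
  have hab : ∀ a b, Q b a = - Q a b := fun a b => congrFun (congrFun hQ a) b
  ext a b
  rcases lt_trichotomy (finSumFinEquiv a) (finSumFinEquiv b) with hlt | heq | hlt
  · exact h ⟨(a, b), hlt⟩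
  · obtain rfl := finSumFinEquiv.injective heq
    have h1 : 2 * Q a a = 0 := by
      rw [two_mul]
      nth_rw 1 [hab]
      simp
    exact (mul_eq_zero.1 h1).resolve_left h2
  · rw [hab b a, h ⟨(b, a), hlt⟩]
    simp

theorem eq_zero_of_transpose_eq {Q : Matrix (Fin n ⊕ Fin n) (Fin n ⊕ Fin n) K} (hQ : Qᵀ = Q)
    (h : ∀ p : WeakPair n, Q p.1.1 p.1.2 = 0) : Q = 0 := by
  ext a b
  rcases le_total (finSumFinEquiv a) (finSumFinEquiv b) with hle | hle
  · exact h ⟨(a, b), hle⟩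
  · rw [← hQ]
    exact h ⟨(b, a), hle⟩

theorem mem_U_of_eqns_eq_zero (h2 : (2 : K) ≠ 0) (ξ : symplecticGroup (Fin n) K)
    {x : Entry g n → K} (hx : ∀ j, eqns (ξ⁻¹).1 x j = 0) (hdet : detAddOne (ξ⁻¹).1 x ≠ 0) :
    x ∈ U g ξ.1 := by
  have hmem : ∀ i, entryMat x i ∈ symplecticGroup (Fin n) K := fun i => by
    rw [SymplecticGroup.mem_iff', ← sub_eq_zero]
    refine eq_zero_of_transpose_eq_neg h2 ?_ fun p => hx (Sum.inl (i, p))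
    rw [transpose_sub, transpose_mul, transpose_mul, J_transpose, transpose_transpose]
    simp [Matrix.mul_assoc, add_comm, sub_eq_add_neg]
  let A : Fin g → symplecticGroup (Fin n) K := fun i => ⟨_, hmem (Sum.inl i)⟩
  let B : Fin g → symplecticGroup (Fin n) K := fun i => ⟨_, hmem (Sum.inr i)⟩
  have hmu : commProd x = (mu A B).1 := commProd_eq_mu A B (fun _ => rfl) fun _ => rfl
  set M := mu A B * ξ⁻¹ with hM
  have hM' : commProd x * (ξ⁻¹).1 = M.1 := by rw [hmu, hM]; rfl
  have hsymm : J (Fin n) K * M.1 + (J (Fin n) K * M.1)ᵀ = 0 := by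
    refine eq_zero_of_transpose_eq (by rw [transpose_add, transpose_transpose, add_comm])
      fun p => ?_
    rw [← hM']
    exact hx (Sum.inr p)
  have hsq : M.1 * M.1 = 1 := by
    have h1 : J (Fin n) K * M.1 = M.1ᵀ * J (Fin n) K := by
      rw [transpose_mul, J_transpose, Matrix.mul_neg, add_neg_eq_zero] at hsymm
      exact hsymm
    have h3 : J (Fin n) K * (M.1 * M.1) = J (Fin n) K := by
      rw [← Matrix.mul_assoc, h1, SymplecticGroup.mem_iff'.1 M.2]
    have h4 := congrArg (fun X => -(J (Fin n) K * X)) h3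
    simpa [← Matrix.mul_assoc, J_squared] using h4
  have hone : M.1 = 1 := by
    have h3 : (M.1 - 1) * (M.1 + 1) = 0 := by
      rw [Matrix.sub_mul, Matrix.mul_add, hsq]
      simp [add_comm]
    have h4 : IsUnit (M.1 + 1).det := by
      rw [← hM']
      exact isUnit_iff_ne_zero.2 hdet
    have h5 := congrArg (· * (M.1 + 1)⁻¹) h3
    simp only [Matrix.zero_mul] at h5
    rw [Matrix.mul_nonsing_inv_cancel_right _ _ h4] at h5
    exact sub_eq_zero.1 h5
  refine ⟨A, B, ?_, ?_⟩
  · have h6 : mu A B = ξ := mul_inv_eq_one.1 (Subtype.ext hone)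
    rw [h6]
  · funext ⟨i, a, b⟩
    rcases i with i | i <;> rfl

theorem eqns_eq_zero_of_mem_U (ξ : symplecticGroup (Fin n) K) {x : Entry g n → K}
    (hx : x ∈ U g ξ.1) (j : EqIndex g n) : eqns (ξ⁻¹).1 x j = 0 := by
  obtain ⟨A, B, hAB, rfl⟩ := hx
  have hmu : commProd (point A B) = (mu A B).1 := commProd_eq_mu A B (fun _ => rfl) fun _ => rfl
  have h1 : ξ.1 * (ξ⁻¹).1 = 1 := by rw [← Submonoid.coe_mul, mul_inv_cancel]; rfl
  rcases j with ⟨i | i, p⟩ | p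
  · change ((A i).1ᵀ * J (Fin n) K * (A i).1 - J (Fin n) K) _ _ = 0
    rw [SymplecticGroup.mem_iff'.1 (A i).2, sub_self, Matrix.zero_apply]
  · change ((B i).1ᵀ * J (Fin n) K * (B i).1 - J (Fin n) K) _ _ = 0
    rw [SymplecticGroup.mem_iff'.1 (B i).2, sub_self, Matrix.zero_apply]
  · simp only [eqns, Sum.elim_inr]
    rw [hmu, hAB, h1, Matrix.mul_one, J_transpose, add_neg_cancel, Matrix.zero_apply]

theorem detAddOne_of_mem_U (ξ : symplecticGroup (Fin n) K) {x : Entry g n → K}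
    (hx : x ∈ U g ξ.1) :
    detAddOne (ξ⁻¹).1 x = (1 + 1 : Matrix (Fin n ⊕ Fin n) (Fin n ⊕ Fin n) K).det := by
  obtain ⟨A, B, hAB, rfl⟩ := hx
  have hmu : commProd (point A B) = (mu A B).1 := commProd_eq_mu A B (fun _ => rfl) fun _ => rfl
  have h1 : ξ.1 * (ξ⁻¹).1 = 1 := by rw [← Submonoid.coe_mul, mul_inv_cancel]; rfl
  rw [detAddOne, hmu, hAB, h1]

theorem det_one_add_one_ne_zero (h2 : (2 : K) ≠ 0) :
    (1 + 1 : Matrix (Fin n ⊕ Fin n) (Fin n ⊕ Fin n) K).det ≠ 0 := by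
  rw [one_add_one_eq_two, ← Matrix.diagonal_ofNat', Matrix.det_diagonal]
  exact Finset.prod_ne_zero_iff.2 fun _ _ => h2

end ZeroLocus

section Differential

variable {K : Type*} [Field K] {g n : ℕ}

/-- The derivative of polynomials in a constant direction. -/
def dirDeriv {σ : Type*} (v : σ → K) :
    Derivation K (MvPolynomial σ K) (MvPolynomial σ K) :=
  MvPolynomial.mkDerivation K fun e => MvPolynomial.C (v e)

theorem dirDeriv_add {σ : Type*} (v w : σ → K) : dirDeriv (v + w) = dirDeriv v + dirDeriv w :=
  MvPolynomial.derivation_ext fun e => by simp [dirDeriv]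

theorem aeval_dualNumber {σ : Type*} (x v : σ → K) (p : MvPolynomial σ K) :
    MvPolynomial.aeval (fun e => (TrivSqZeroExt.inl (x e) + TrivSqZeroExt.inr (v e) : DualNumber K))
      p = TrivSqZeroExt.inl (MvPolynomial.eval x p) +
        TrivSqZeroExt.inr (MvPolynomial.eval x (dirDeriv v p)) := by
  induction p using MvPolynomial.induction_on with
  | C a =>
    rw [MvPolynomial.aeval_C, ← MvPolynomial.algebraMap_eq, Derivation.map_algebraMap]
    simp [TrivSqZeroExt.algebraMap_eq_inl]
  | add p q hp hq =>
    rw [map_add, hp, hq]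
    simp only [map_add, TrivSqZeroExt.inl_add, TrivSqZeroExt.inr_add]
    abel
  | mul_X p e hp =>
    rw [map_mul, hp, MvPolynomial.aeval_X, (dirDeriv v).leibniz]
    ext
    · simp
    · simp [dirDeriv, mul_comm, add_comm]

theorem eval_dirDeriv_eqns (ξ : symplecticGroup (Fin n) K) (x v : Entry g n → K)
    (j : EqIndex g n) :
    MvPolynomial.eval x (dirDeriv v (eqns ((ξ⁻¹).1.map MvPolynomial.C) MvPolynomial.X j)) =
      (eqns (dual (ξ⁻¹).1 0)
        (fun e => (TrivSqZeroExt.inl (x e) + TrivSqZeroExt.inr (v e) : DualNumber K)) j).snd := by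
  have h := aeval_dualNumber x v (eqns ((ξ⁻¹).1.map MvPolynomial.C) MvPolynomial.X j)
  have h1 := map_eqns (MvPolynomial.aeval (R := K)
    (fun e => (TrivSqZeroExt.inl (x e) + TrivSqZeroExt.inr (v e) : DualNumber K))).toRingHom
    ((ξ⁻¹).1.map MvPolynomial.C) MvPolynomial.X j
  have h3 : (MvPolynomial.aeval (R := K) (fun e =>
      (TrivSqZeroExt.inl (x e) + TrivSqZeroExt.inr (v e) : DualNumber K))).toRingHom.mapMatrix
        ((ξ⁻¹).1.map MvPolynomial.C) = dual (ξ⁻¹).1 0 := by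
    rw [← map_inl_eq_dual]
    ext1 a b
    simp [TrivSqZeroExt.algebraMap_eq_inl]
  rw [h3] at h1
  simp only [AlgHom.toRingHom_eq_coe, RingHom.coe_coe, MvPolynomial.aeval_X] at h1
  rw [← h1, h]
  simp

theorem entryMat_dual (x v : Entry g n → K) (i : Fin g ⊕ Fin g) :
    entryMat (fun e => (TrivSqZeroExt.inl (x e) + TrivSqZeroExt.inr (v e) : DualNumber K)) i =
      dual (entryMat x i) (entryMat v i) := rfl

theorem exists_eqns_inl_eq (ξ : symplecticGroup (Fin n) K)
    (A B : Fin g → symplecticGroup (Fin n) K) (t : (Fin g ⊕ Fin g) × StrictPair n → K) :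
    ∃ v : Entry g n → K, ∀ j, (eqns (dual (ξ⁻¹).1 0) (fun e =>
      (TrivSqZeroExt.inl (point A B e) + TrivSqZeroExt.inr (v e) : DualNumber K))
        (Sum.inl j)).snd = t j := by
  let X : Fin g ⊕ Fin g → symplecticGroup (Fin n) K := Sum.elim A B
  have hX : ∀ i, entryMat (point A B) i = (X i).1 := by rintro (i | i) <;> rfl
  let Y : Fin g ⊕ Fin g → Matrix (Fin n ⊕ Fin n) (Fin n ⊕ Fin n) K := fun i =>
    Matrix.of fun a b => if h : finSumFinEquiv a < finSumFinEquiv b then t (i, ⟨(a, b), h⟩) else 0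
  let V : Fin g ⊕ Fin g → Matrix (Fin n ⊕ Fin n) (Fin n ⊕ Fin n) K := fun i =>
    -(J (Fin n) K) * ((X i)⁻¹).1ᵀ * Y i
  refine ⟨fun e => V e.1 e.2.1 e.2.2, fun ⟨i, p⟩ => ?_⟩
  have hV : (X i).1ᵀ * J (Fin n) K * V i = Y i := by
    have h1 : (X i).1ᵀ * ((X i)⁻¹).1ᵀ = 1 := by
      rw [← transpose_mul, ← Submonoid.coe_mul, inv_mul_cancel]
      simp
    simp only [V]
    rw [← Matrix.mul_assoc, ← Matrix.mul_assoc, Matrix.mul_assoc _ (J (Fin n) K), Matrix.mul_neg,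
      J_squared, neg_neg, Matrix.mul_one, h1, Matrix.one_mul]
  have hV' : (V i)ᵀ * J (Fin n) K * (X i).1 = -(Y i)ᵀ := by
    have h3 : ∀ P Q : Matrix (Fin n ⊕ Fin n) (Fin n ⊕ Fin n) K,
        Pᵀ * J (Fin n) K * Q = -(Qᵀ * J (Fin n) K * P)ᵀ := fun P Q => by
      rw [transpose_mul, transpose_mul, J_transpose, transpose_transpose]
      simp [Matrix.mul_assoc]
    rw [h3, hV]
  have h3 : (dual (X i).1 (V i))ᵀ * J (Fin n) (DualNumber K) * dual (X i).1 (V i) -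
      J (Fin n) (DualNumber K) = dual 0 (Y i - (Y i)ᵀ) := by
    rw [J_eq_dual, transpose_dual, dual_mul, dual_mul, SymplecticGroup.mem_iff'.1 (X i).2,
      Matrix.mul_zero, zero_add, hV, hV']
    refine dual_ext (fun a b => ?_) fun a b => ?_
    · simp [fst_dual]
    · simp [snd_dual, sub_eq_add_neg]
  have hV'' : entryMat (fun e => V e.1 e.2.1 e.2.2) i = V i := rfl
  simp only [eqns, Sum.elim_inl]
  rw [entryMat_dual, hX, hV'']
  change (((dual (X i).1 (V i))ᵀ * J (Fin n) (DualNumber K) * dual (X i).1 (V i) -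
      J (Fin n) (DualNumber K)) p.1.1 p.1.2).snd = _
  rw [h3, snd_dual]
  simp [Y, p.2, p.2.le]

theorem exists_eqns_inr_eq (h2 : (2 : K) ≠ 0) {φ : K} (hφ : φ ≠ 0) {k : Fin n → ℕ}
    (hk : Generic φ k) (ξ : symplecticGroup (Fin n) K) (hξ : ξ.1 = xi φ k)
    {A B : Fin g → symplecticGroup (Fin n) K} (hAB : mu A B = ξ) (t : WeakPair n → K) :
    ∃ v : Entry g n → K,
      (∀ j, (eqns (dual (ξ⁻¹).1 0) (fun e =>
        (TrivSqZeroExt.inl (point A B e) + TrivSqZeroExt.inr (v e) : DualNumber K))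
          (Sum.inl j)).snd = 0) ∧
      ∀ j, (eqns (dual (ξ⁻¹).1 0) (fun e =>
        (TrivSqZeroExt.inl (point A B e) + TrivSqZeroExt.inr (v e) : DualNumber K))
          (Sum.inr j)).snd = t j := by
  let S : Matrix (Fin n ⊕ Fin n) (Fin n ⊕ Fin n) K := Matrix.of fun a b =>
    if h : finSumFinEquiv a ≤ finSumFinEquiv b then t ⟨(a, b), h⟩ else
      t ⟨(b, a), le_of_not_ge h⟩
  have hS : Sᵀ = S := by
    ext a b
    simp only [S, transpose_apply, Matrix.of_apply]
    split_ifs with h1 h3 h3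
    · obtain rfl := finSumFinEquiv.injective (le_antisymm h1 h3)
      rfl
    · rfl
    · rfl
    · exact absurd (le_of_not_ge h1) h3
  let Z : Matrix (Fin n ⊕ Fin n) (Fin n ⊕ Fin n) K := (2 : K)⁻¹ • -(J (Fin n) K * S)
  have hJZ : J (Fin n) K * Z = (2 : K)⁻¹ • S := by
    simp only [Z]
    rw [Matrix.mul_smul, Matrix.mul_neg, ← Matrix.mul_assoc, J_squared]
    simp
  have hZ : Z ∈ sp K n := by rw [mem_sp_iff, hJZ, transpose_smul, hS]
  obtain ⟨⟨X, Y⟩, hXY⟩ := dmu_surjective h2 hφ hk (by rw [hAB, hξ])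
    (tangentMk (mu A B) ⟨Z, hZ⟩)
  have hXY' : mu (fun i => (X i).1) (fun i => (Y i).1) =
      spExp ⟨Z, hZ⟩ * spHom n (TrivSqZeroExt.inlHom K K) ξ := by
    rw [← hAB]
    exact congrArg Subtype.val hXY
  let v : Entry g n → K := fun e =>
    (Sum.elim (fun i => (X i).1.1) (fun i => (Y i).1.1) e.1 e.2.1 e.2.2).snd
  set y : Entry g n → DualNumber K := fun e =>
    (TrivSqZeroExt.inl (point A B e) + TrivSqZeroExt.inr (v e) : DualNumber K) with hy
  have hX : ∀ i, entryMat y (Sum.inl i) = (X i).1.1 := fun i => by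
    refine dual_ext (fun a b => ?_) fun a b => ?_
    · have h3 := congrFun (congrFun (congrArg Subtype.val (X i).2) a) b
      simp only [hy, entryMat, Matrix.of_apply, TrivSqZeroExt.fst_add, TrivSqZeroExt.fst_inl,
        TrivSqZeroExt.fst_inr, add_zero]
      exact h3.symm
    · simp [hy, entryMat, v]
  have hY : ∀ i, entryMat y (Sum.inr i) = (Y i).1.1 := fun i => by
    refine dual_ext (fun a b => ?_) fun a b => ?_
    · have h3 := congrFun (congrFun (congrArg Subtype.val (Y i).2) a) b
      simp only [hy, entryMat, Matrix.of_apply, TrivSqZeroExt.fst_add, TrivSqZeroExt.fst_inl,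
        TrivSqZeroExt.fst_inr, add_zero]
      exact h3.symm
    · simp [hy, entryMat, v]
  refine ⟨v, fun ⟨i, p⟩ => ?_, fun p => ?_⟩
  · change (((entryMat y i)ᵀ * J (Fin n) (DualNumber K) * entryMat y i -
      J (Fin n) (DualNumber K)) p.1.1 p.1.2).snd = _
    have hmem : entryMat y i ∈ symplecticGroup (Fin n) (DualNumber K) := by
      rcases i with i | i
      · rw [hX]; exact (X i).1.2
      · rw [hY]; exact (Y i).1.2
    rw [SymplecticGroup.mem_iff'.1 hmem, sub_self]
    rfl
  · have hM : commProd y * dual (ξ⁻¹).1 0 = dual 1 Z := by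
      rw [commProd_eq_mu _ _ hX hY, hXY', ← map_inl_eq_dual]
      have h3 : spHom n (TrivSqZeroExt.inlHom K K) ξ *
          spHom n (TrivSqZeroExt.inlHom K K) ξ⁻¹ = 1 := by
        rw [← map_mul, mul_inv_cancel, map_one]
      have h4 : spExp ⟨Z, hZ⟩ * spHom n (TrivSqZeroExt.inlHom K K) ξ *
          spHom n (TrivSqZeroExt.inlHom K K) ξ⁻¹ = spExp ⟨Z, hZ⟩ := by
        rw [mul_assoc, h3, mul_one]
      exact congrArg Subtype.val h4
    simp only [eqns, Sum.elim_inr]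
    have hSp : S p.1.2 p.1.1 = S p.1.1 p.1.2 := congrFun (congrFun hS p.1.1) p.1.2
    rw [hM, J_eq_dual, dual_mul, Matrix.add_apply, TrivSqZeroExt.snd_add, transpose_apply, snd_dual,
      snd_dual, Matrix.zero_mul, add_zero, hJZ, Matrix.smul_apply, Matrix.smul_apply, hSp,
      ← smul_add, ← two_mul, smul_eq_mul, inv_mul_cancel_left₀ h2]
    exact dif_pos p.2

/-- The differentials of the local equations are linearly independent at the points of `U`. -/
theorem exists_eval_dirDeriv_eqns_eq (h2 : (2 : K) ≠ 0) {φ : K} (hφ : φ ≠ 0) {k : Fin n → ℕ}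
    (hk : Generic φ k) (ξ : symplecticGroup (Fin n) K) (hξ : ξ.1 = xi φ k) {x : Entry g n → K}
    (hx : x ∈ U g ξ.1) (t : EqIndex g n → K) :
    ∃ v : Entry g n → K, ∀ j, MvPolynomial.eval x
      (dirDeriv v (eqns ((ξ⁻¹).1.map MvPolynomial.C) MvPolynomial.X j)) = t j := by
  obtain ⟨A, B, hAB, rfl⟩ := hx
  obtain ⟨v, hv⟩ := exists_eqns_inl_eq ξ A B fun j => t (Sum.inl j)
  obtain ⟨w, hw, hw'⟩ := exists_eqns_inr_eq h2 hφ hk ξ hξ (Subtype.ext hAB) fun j =>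
    t (Sum.inr j) - MvPolynomial.eval (point A B)
      (dirDeriv v (eqns ((ξ⁻¹).1.map MvPolynomial.C) MvPolynomial.X (Sum.inr j)))
  simp only [← eval_dirDeriv_eqns] at hv hw hw'
  refine ⟨v + w, ?_⟩
  rintro (j | j)
  · rw [dirDeriv_add, Derivation.add_apply, map_add, hv, hw, add_zero]
  · rw [dirDeriv_add, Derivation.add_apply, map_add, hw', add_sub_cancel]

end Differential

section Counting

theorem exists_nat_eq_ringKrullDim {R : Type*} [CommRing R] [IsRegularLocalRing R] {c N : ℕ}
    (h : ringKrullDim R + c = N) : ∃ e : ℕ, ringKrullDim R = e ∧ e + c = N := by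
  rw [← IsRegularLocalRing.spanFinrank_maximalIdeal] at h ⊢
  exact ⟨_, rfl, by exact_mod_cast h⟩

theorem card_weakPair (n : ℕ) :
    Fintype.card (WeakPair n) = n * (2 * n + 1) ∧
      Fintype.card (StrictPair n) + 2 * n = Fintype.card (WeakPair n) := by
  classical
  let e : Fin n ⊕ Fin n ≃ Fin (n + n) := finSumFinEquiv
  have h1 : Fintype.card (StrictPair n) + 2 * n = Fintype.card (WeakPair n) := by
    rw [Fintype.card_subtype, Fintype.card_subtype]
    have hdiag : (Finset.univ.filter fun p : (Fin n ⊕ Fin n) × (Fin n ⊕ Fin n) =>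
        e p.1 = e p.2).card = 2 * n := by
      have : (Finset.univ.filter fun p : (Fin n ⊕ Fin n) × (Fin n ⊕ Fin n) =>
          e p.1 = e p.2) = (Finset.univ : Finset (Fin n ⊕ Fin n)).diag := by
        ext p
        simp [Finset.mem_diag]
      rw [this, Finset.diag_card, Finset.card_univ, Fintype.card_sum, Fintype.card_fin, two_mul]
    rw [← hdiag, ← Finset.card_union_of_disjoint, ← Finset.filter_or]
    · simp only [e, le_iff_lt_or_eq]
    · exact Finset.disjoint_filter.2 fun p _ h h' => h.ne h'
  have h2 : Fintype.card (StrictPair n) = Fintype.card {p : (Fin n ⊕ Fin n) × (Fin n ⊕ Fin n) //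
      ¬ finSumFinEquiv p.1 ≤ finSumFinEquiv p.2} :=
    Fintype.card_congr ((Equiv.prodComm _ _).subtypeEquiv fun p => by simp)
  rw [Fintype.card_subtype_compl, Fintype.card_prod, Fintype.card_sum, Fintype.card_fin] at h2
  have h3 : Fintype.card (WeakPair n) ≤ (n + n) * (n + n) := by
    refine (Fintype.card_subtype_le _).trans ?_
    simp
  refine ⟨?_, h1⟩
  have h4 : Fintype.card (StrictPair n) + Fintype.card (WeakPair n) = (n + n) * (n + n) := by
    rw [h2]
    exact Nat.sub_add_cancel h3
  nlinarith

theorem card_entry_eq {g n e : ℕ}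
    (h : e + Fintype.card (EqIndex g n) = Fintype.card (Entry g n)) :
    e = (2 * g - 1) * (n * (2 * n + 1)) := by
  obtain ⟨h1, h2⟩ := card_weakPair n
  simp only [Fintype.card_sum, Fintype.card_prod, Fintype.card_fin] at h
  rw [h1] at h h2
  obtain ⟨l, hl⟩ : ∃ l, Fintype.card (StrictPair n) = l := ⟨_, rfl⟩
  rw [hl] at h h2
  rcases g with _ | g
  · simp at h ⊢
    omega
  · have h3 : 2 * (g + 1) - 1 = 2 * g + 1 := by omega
    rw [h3]
    nlinarith

end Counting

section Points

variable {K : Type*} [Field K] {n : ℕ}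

theorem diagonal_mem_symplecticGroup {d d' : Fin n → K} (h : ∀ i, d i * d' i = 1) :
    Matrix.diagonal (Sum.elim d d') ∈ symplecticGroup (Fin n) K := by
  rw [← Matrix.fromBlocks_diagonal, SymplecticGroup.fromBlocks_mem_iff]
  simp [Matrix.diagonal_mul_diagonal, h]

theorem J_mul_diagonal (d d' : Fin n → K) :
    J (Fin n) K * Matrix.diagonal (Sum.elim d d') =
      Matrix.diagonal (Sum.elim d' d) * J (Fin n) K := by
  rw [← Matrix.fromBlocks_diagonal, ← Matrix.fromBlocks_diagonal, J, Matrix.fromBlocks_multiply,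
    Matrix.fromBlocks_multiply]
  simp

theorem xi_mem_symplecticGroup {φ : K} (hφ : φ ≠ 0) (k : Fin n → ℕ) :
    xi φ k ∈ symplecticGroup (Fin n) K :=
  diagonal_mem_symplecticGroup fun _ => mul_inv_cancel₀ (pow_ne_zero _ hφ)

/-- For `g > 0` the element `ξ` is a product of commutators: it is `[J, t]` for a diagonal `t` with
`t ^ (-2) = ξ`. -/
theorem U_nonempty [IsAlgClosed K] {g : ℕ} (hg : 0 < g) {φ : K} (hφ : φ ≠ 0) (k : Fin n → ℕ) :
    (U g (xi φ k)).Nonempty := by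
  obtain ⟨g, rfl⟩ := Nat.exists_eq_succ_of_ne_zero hg.ne'
  choose s hs using fun i => IsAlgClosed.exists_pow_nat_eq (φ ^ k i) (n := 2) two_pos
  have hs0 : ∀ i, s i ≠ 0 := fun i h => pow_ne_zero (k i) hφ (by rw [← hs, h]; simp)
  let t : symplecticGroup (Fin n) K :=
    ⟨_, diagonal_mem_symplecticGroup (d := fun i => (s i)⁻¹) (d' := s) fun i => inv_mul_cancel₀ (hs0 i)⟩
  have ht : SymplecticGroup.symJ (Fin n) K * t * (SymplecticGroup.symJ (Fin n) K)⁻¹ * t⁻¹ =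
      ⟨xi φ k, xi_mem_symplecticGroup hφ k⟩ := by
    rw [mul_inv_eq_iff_eq_mul, mul_inv_eq_iff_eq_mul]
    refine Subtype.ext ?_
    change J (Fin n) K * Matrix.diagonal (Sum.elim (fun i => (s i)⁻¹) s) =
      xi φ k * Matrix.diagonal (Sum.elim (fun i => (s i)⁻¹) s) * J (Fin n) K
    rw [J_mul_diagonal, xi, Matrix.diagonal_mul_diagonal]
    congr 2
    funext a
    rcases a with i | i
    · simp only [Sum.elim_inl]
      rw [← hs, pow_two, mul_inv_cancel_right₀ (hs0 i)]
    · simp only [Sum.elim_inr]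
      rw [← hs, pow_two, _root_.mul_inv_rev, inv_mul_cancel_right₀ (hs0 i)]
  let A : Fin (g + 1) → symplecticGroup (Fin n) K :=
    Fin.cons (SymplecticGroup.symJ (Fin n) K) fun _ => 1
  let B : Fin (g + 1) → symplecticGroup (Fin n) K := Fin.cons t fun _ => 1
  refine ⟨point A B, A, B, ?_, rfl⟩
  have h1 : mu A B = ⟨xi φ k, xi_mem_symplecticGroup hφ k⟩ := by
    rw [mu_succ, ← ht]
    simp [A, B, mu]
  rw [h1]

end Points

section Local

variable {K : Type*} [Field K] {g n : ℕ}

/-- At all its points the variety `U` is regular; at the closed points its dimension is the number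
of coordinates minus the number of local equations. -/
theorem isRegularLocalRing_localization_coordRing [IsAlgClosed K] (h2 : (2 : K) ≠ 0) {φ : K}
    (hφ : φ ≠ 0) {k : Fin n → ℕ} (hk : Generic φ k) (q : Ideal (CoordRing g (xi φ k)))
    [hq : q.IsPrime] :
    IsRegularLocalRing (Localization.AtPrime q) ∧
      (q.IsMaximal → ringKrullDim (Localization.AtPrime q) + Fintype.card (EqIndex g n) =
        Fintype.card (Entry g n)) := by
  set I := MvPolynomial.vanishingIdeal K (U g (xi φ k)) with hI
  let ξ : symplecticGroup (Fin n) K := ⟨xi φ k, xi_mem_symplecticGroup hφ k⟩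
  let F : EqIndex g n → MvPolynomial (Entry g n) K :=
    eqns ((ξ⁻¹).1.map MvPolynomial.C) MvPolynomial.X
  let h : MvPolynomial (Entry g n) K :=
    detAddOne ((ξ⁻¹).1.map MvPolynomial.C) MvPolynomial.X
  have hC : ∀ x : Entry g n → K, (MvPolynomial.eval x).mapMatrix ((ξ⁻¹).1.map MvPolynomial.C) =
      (ξ⁻¹).1 := fun x => by
    ext a b
    simp
  have hF : ∀ x j, MvPolynomial.eval x (F j) = eqns (ξ⁻¹).1 x j := fun x j => by
    rw [map_eqns, hC]
    simp only [MvPolynomial.eval_X]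
  have hh : ∀ x, MvPolynomial.eval x h = detAddOne (ξ⁻¹).1 x := fun x => by
    rw [map_detAddOne, hC]
    simp only [MvPolynomial.eval_X]
  set p := q.comap (Ideal.Quotient.mk I) with hp
  have hIp : I ≤ p := fun a ha => by
    rw [hp, Ideal.mem_comap, Ideal.Quotient.eq_zero_iff_mem.2 ha]
    exact q.zero_mem
  obtain ⟨m, hm, hpm⟩ := Ideal.exists_le_maximal p (Ideal.IsPrime.ne_top')
  obtain ⟨x, hx⟩ := MvPolynomial.isMaximal_iff_eq_vanishingIdeal_singleton.1 hm
  have hev : ∀ a ∈ p, MvPolynomial.eval x a = 0 := fun a ha => by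
    have := hpm ha
    rw [hx, MvPolynomial.mem_vanishingIdeal_singleton_iff] at this
    simpa using this
  have hFI : ∀ j, F j ∈ I := fun j => by
    rw [hI, MvPolynomial.mem_vanishingIdeal_iff]
    intro y hy
    have : MvPolynomial.eval y (F j) = 0 := by rw [hF]; exact eqns_eq_zero_of_mem_U ξ hy j
    simpa using this
  have hrad : ∀ a ∈ I, h * a ∈ (Ideal.span (Set.range F)).radical := fun a ha => by
    rw [← MvPolynomial.vanishingIdeal_zeroLocus_eq_radical (K := K),
      MvPolynomial.mem_vanishingIdeal_iff]
    intro y hy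
    rw [MvPolynomial.zeroLocus_span] at hy
    have hy' : ∀ j, eqns (ξ⁻¹).1 y j = 0 := fun j => by
      rw [← hF]
      simpa using hy (F j) ⟨j, rfl⟩
    rw [map_mul]
    by_cases hhy : detAddOne (ξ⁻¹).1 y = 0
    · have : MvPolynomial.aeval y h = 0 := by simpa [hh] using hhy
      rw [this, zero_mul]
    · have hyU : y ∈ U g ξ.1 := mem_U_of_eqns_eq_zero h2 ξ hy' hhy
      rw [(MvPolynomial.mem_vanishingIdeal_iff.1 ha) y hyU, mul_zero]
  have hxU : x ∈ U g ξ.1 := by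
    have hconst : h - MvPolynomial.C (1 + 1 : Matrix (Fin n ⊕ Fin n) (Fin n ⊕ Fin n) K).det ∈ I := by
      rw [hI, MvPolynomial.mem_vanishingIdeal_iff]
      intro y hy
      have : MvPolynomial.eval y h = (1 + 1 : Matrix (Fin n ⊕ Fin n) (Fin n ⊕ Fin n) K).det := by
        rw [hh]
        exact detAddOne_of_mem_U ξ hy
      simpa [sub_eq_zero] using this
    refine mem_U_of_eqns_eq_zero h2 ξ (fun j => by rw [← hF, hev _ (hIp (hFI j))]) ?_
    have h1 := hev _ (hIp hconst)
    rw [map_sub, hh, MvPolynomial.eval_C, sub_eq_zero] at h1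
    rw [h1]
    exact det_one_add_one_ne_zero h2
  have hhp : h ∉ p := fun hmem => by
    have h1 := hev _ hmem
    rw [hh, detAddOne_of_mem_U ξ hxU] at h1
    exact det_one_add_one_ne_zero h2 h1
  classical
  choose v hv using fun i : EqIndex g n =>
    exists_eval_dirDeriv_eqns_eq h2 hφ hk ξ rfl hxU (Pi.single i 1)
  have hdet : (Matrix.of fun i j => dirDeriv (v i) (F j)).det ∉ p := fun hmem => by
    have h1 := hev _ hmem
    rw [RingHom.map_det] at h1
    have h3 : (MvPolynomial.eval x).mapMatrix (Matrix.of fun i j => dirDeriv (v i) (F j)) = 1 := by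
      ext i j
      rw [RingHom.mapMatrix_apply, Matrix.map_apply, Matrix.of_apply, hv, Matrix.one_apply,
        Pi.single_apply]
      simp only [eq_comm]
    rw [h3, Matrix.det_one] at h1
    exact one_ne_zero h1
  obtain ⟨hreg, hdim⟩ := isRegularLocalRing_quotient_of_det_notMem I q F (fun i => dirDeriv (v i)) h
    hFI hhp hrad hdet
  refine ⟨hreg, fun hqm => ?_⟩
  have hpmax : p.IsMaximal := Ideal.comap_isMaximal_of_surjective _ Ideal.Quotient.mk_surjective
  have hpm' : p = m := hpmax.eq_of_le hm.ne_top hpm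
  rw [hdim]
  refine ringKrullDim_localization_mvPolynomial x p hev fun a ha => ?_
  rw [hpm', hx, MvPolynomial.mem_vanishingIdeal_singleton_iff]
  simpa using ha

end Local

end

end SpCharVar

theorem mainTheorem7 {K : Type*} [Field K] [IsAlgClosed K] (hchar : ringChar K ≠ 2)
    (g n m : ℕ) (hm : 0 < m) (φ : K) (hφ : IsPrimitiveRoot φ m)
    (k : Fin n → ℕ) (hk : SpCharVar.Generic φ k) :
    -- `U` is nonsingular
    IsRegularRing (SpCharVar.CoordRing g (SpCharVar.xi φ k)) ∧
    -- every irreducible component has dimension `(2g - 1) n (2n + 1)`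
    (∀ Z ∈ irreducibleComponents
        (PrimeSpectrum (SpCharVar.CoordRing g (SpCharVar.xi φ k))),
      topologicalKrullDim Z = (((2 * g - 1) * (n * (2 * n + 1)) : ℕ) : WithBot ℕ∞)) ∧
    -- so does every connected component
    (∀ p : PrimeSpectrum (SpCharVar.CoordRing g (SpCharVar.xi φ k)),
      topologicalKrullDim (connectedComponent p) =
        (((2 * g - 1) * (n * (2 * n + 1)) : ℕ) : WithBot ℕ∞)) ∧
    -- and `U` itself, which is nonempty for `g > 0`
    (0 < g → topologicalKrullDim
        (PrimeSpectrum (SpCharVar.CoordRing g (SpCharVar.xi φ k))) =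
      (((2 * g - 1) * (n * (2 * n + 1)) : ℕ) : WithBot ℕ∞)) ∧
    -- the differential of `μ` is surjective at every point of `U`
    (∀ A B : Fin g → Matrix.symplecticGroup (Fin n) K,
      (SpCharVar.mu A B).1 = SpCharVar.xi φ k →
      Function.Surjective (SpCharVar.dmu A B)) := by
  have h2 : (2 : K) ≠ 0 := Ring.two_ne_zero hchar
  have hφ0 : φ ≠ 0 := hφ.ne_zero hm.ne'
  have hloc := fun (q : Ideal (SpCharVar.CoordRing g (SpCharVar.xi φ k))) [q.IsPrime] =>
    SpCharVar.isRegularLocalRing_localization_coordRing h2 hφ0 hk q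
  obtain ⟨hirr, hconn, hall⟩ := SpCharVar.topologicalKrullDim_eq_of_localization
    ((2 * g - 1) * (n * (2 * n + 1)))
    (fun (q : Ideal (SpCharVar.CoordRing g (SpCharVar.xi φ k))) _ =>
      have := (hloc q).1
      SpCharVar.isDomain_of_isRegularLocalRing _)
    (fun q hq => by
      have hdim := (hloc q).2 hq
      have hreg := (hloc q).1
      obtain ⟨e, he, hadd⟩ := SpCharVar.exists_nat_eq_ringKrullDim (R := Localization.AtPrime q) hdim
      rw [← SpCharVar.card_entry_eq hadd]
      exact he)
  refine ⟨isRegularRing_iff.2 fun q _ => (hloc q).1, hirr, hconn, fun hg => hall ?_,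
    fun A B hAB => SpCharVar.dmu_surjective h2 hφ0 hk hAB⟩
  obtain ⟨x, hx⟩ := SpCharVar.U_nonempty hg hφ0 k
  refine Ideal.Quotient.nontrivial_iff.2 fun htop => ?_
  have h1 : (1 : MvPolynomial (SpCharVar.Entry g n) K) ∈
      MvPolynomial.vanishingIdeal K (SpCharVar.U g (SpCharVar.xi φ k)) := htop ▸ Submodule.mem_top
  simpa using MvPolynomial.mem_vanishingIdeal_iff.1 h1 x hx
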